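/- Let $n\ge 1$ be an integer, let $\gamma\in\big(0,\min\{2,\tfrac n2\}\big)$, and let $p$ satisfy $$1<p<p_{\mathrm{crit}}(n,\gamma):=1+\frac{4}{n+2\gamma},\qquad 1+\frac{2\gamma}{n}\le p,\qquad\text{and}\quad p\le\frac{n}{n-2}\ \text{ if } n\ge 3 .$$ Put $p'=\frac{p}{p-1}$. Let $\dot H^{-\gamma}$ be the space with norm $\|f\|_{\dot H^{-\gamma}}=\|\mathcal F^{-1}(|\xi|^{-\gamma}\hat f)\|_{L^2}$, and let $\mathcal A_1:=(H^1\cap\dot H^{-\gamma})\times(L^2\cap\dot H^{-\gamma})$ on $\mathbb R^n$, with $$\|(u_0,u_1)\|_{\mathcal A_1}=\|u_0\|_{H^1}+\|u_0\|_{\dot H^{-\gamma}}+\|u_1\|_{L^2}+\|u_1\|_{\dot H^{-\gamma}}.$$ For $(u_0,u_1)\in\mathcal A_1$ and $\epsilon>0$ consider the Cauchy problem $$u_{tt}-\Delta u+u_t=|u|^p\ \ (x\in\mathbb R^n,\ t>0),\qquad u(0,x)=\epsilon u_0(x),\quad u_t(0,x)=\epsilon u_1(x).$$ A mild solution on $[0,T)$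 is a function $u\in\mathcal C([0,T),H^1)$ such that, for all $t\in[0,T)$, $$u(t)=\epsilon E_0(t)\ast u_0+\epsilon E_1(t)\ast u_1+\int_0^tE_1(t-\tau)\ast|u(\tau)|^p\,\mathrm d\tau ,$$ the integral being an integral of an integrable $L^2$-valued function, where $E_0$ and $E_1$ are the fundamental solutions of the linear equation $v_{tt}-\Delta v+v_t=0$ with data $(v,v_t)(0)=(\delta_0,0)$ and $(0,\delta_0)$, respectively, and $\ast$ is the convolution in $x$. The lifespan is $$T_{\epsilon,\mathrm m}:=\sup\{T>0:\ \text{there exists a unique mild solution on }[0,T)\}\in[0,\infty].$$ Then there is a positive constant $C$, which depends only on $p$, $n$, $\gamma$ and $\|(u_0,u_1)\|_{\mathcal A_1}$, such that for every $(u_0,u_1)\in\mathcal A_1$ there is a constant $\epsilon_2>0$ with $$T_{\epsilon,\mathrm m}\ \ge\ C\,\epsilon^{-\frac{2}{2p'-2-\frac n2-\gamma}}\qquad\text{for all }\epsilon\in(0,\epsilon_2].$$ -/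

import Mathlib

open MeasureTheory Set Filter Topology FourierTransform
open scoped ENNReal

noncomputable section

namespace DampedWave

/-- The physical (and frequency) space `ℝⁿ` with its Euclidean norm. -/
abbrev Rn (n : ℕ) : Type := EuclideanSpace ℝ (Fin n)

/-- The space `L²(ℝⁿ)` of complex-valued functions. -/
abbrev L2 (n : ℕ) : Type := Lp ℂ 2 (volume : Measure (Rn n))

/-! ### Sobolev spaces

Mathlib's Fourier transform is `𝓕 f ξ = ∫ exp (-2πi x·ξ) f x dx`, so the operator `-Δ` has the
symbol `(2π‖ξ‖)²`; the frequency variable of the usual convention is `2πξ`, and Plancherel's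
identity holds with constant one. -/

/-- The norm of the inhomogeneous Sobolev space `Hˢ`, as an extended number:
`‖(1 - Δ)^{s/2} f‖_{L²}`. A function `f ∈ L²` belongs to `Hˢ`, `s ≥ 0`, iff this is finite. -/
def sobolevNorm {n : ℕ} (s : ℝ) (f : L2 n) : ℝ≥0∞ :=
  eLpNorm (fun ξ : Rn n =>
    (((1 + (2 * Real.pi * ‖ξ‖) ^ 2) ^ (s / 2) : ℝ) : ℂ) * (𝓕 f : L2 n) ξ) 2 volume

/-- The norm of the homogeneous Sobolev space of negative order `Ḣ^{-γ}`, as an extended number: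
`‖(-Δ)^{-γ/2} f‖_{L²} = ‖|ξ|^{-γ} f̂‖_{L²}`. A function `f ∈ L²` (a tempered distribution, whose
class modulo polynomials determines it) belongs to `Ḣ^{-γ}` iff this is finite. -/
def negSobolevNorm {n : ℕ} (γ : ℝ) (f : L2 n) : ℝ≥0∞ :=
  eLpNorm (fun ξ : Rn n =>
    (((2 * Real.pi * ‖ξ‖) ^ (-γ) : ℝ) : ℂ) * (𝓕 f : L2 n) ξ) 2 volume

/-- `(u₀, u₁) ∈ 𝒜₁ = (H¹ ∩ Ḣ^{-γ}) × (L² ∩ Ḣ^{-γ})`. -/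
def MemDataSpace {n : ℕ} (γ : ℝ) (u₀ u₁ : L2 n) : Prop :=
  sobolevNorm 1 u₀ < ∞ ∧ negSobolevNorm γ u₀ < ∞ ∧ negSobolevNorm γ u₁ < ∞

/-- The norm of `𝒜₁ = (H¹ ∩ Ḣ^{-γ}) × (L² ∩ Ḣ^{-γ})`. -/
def dataNorm {n : ℕ} (γ : ℝ) (u₀ u₁ : L2 n) : ℝ :=
  (sobolevNorm 1 u₀).toReal + (negSobolevNorm γ u₀).toReal +
    ‖u₁‖ + (negSobolevNorm γ u₁).toReal

/-! ### The fundamental solutions of the linear damped wave equation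

After a Fourier transform in space, `v_tt - Δv + v_t = 0` is the family of ordinary differential
equations `w'' + w' + r² w = 0` with `r = 2π‖ξ‖`. The fundamental solutions `E₀(t)`, `E₁(t)` have
as spatial Fourier transforms the solutions `K₀`, `K₁` with the data `(w, w')(0) = (1, 0)` and
`(0, 1)`, the Fourier transforms of `(δ₀, 0)` and `(0, δ₀)`. -/

/-- The root `λ₁ = (-1 + √(1 - 4r²)) / 2` of `λ² + λ + r² = 0`. -/
def lam1 (r : ℝ) : ℂ := (-1 + (1 - 4 * (r : ℂ) ^ 2) ^ ((2 : ℂ)⁻¹)) / 2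

/-- The root `λ₂ = (-1 - √(1 - 4r²)) / 2` of `λ² + λ + r² = 0`. -/
def lam2 (r : ℝ) : ℂ := (-1 - (1 - 4 * (r : ℂ) ^ 2) ^ ((2 : ℂ)⁻¹)) / 2

open Classical in
/-- The spatial Fourier transform of `E₁(t)` at radius `r`. -/
def K1 (t r : ℝ) : ℂ :=
  if lam1 r = lam2 r then t * Complex.exp (-(t : ℂ) / 2)
  else (Complex.exp (lam1 r * t) - Complex.exp (lam2 r * t)) / (lam1 r - lam2 r)

open Classical in
/-- The spatial Fourier transform of `E₀(t)` at radius `r`. -/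
def K0 (t r : ℝ) : ℂ :=
  if lam1 r = lam2 r then (1 + (t : ℂ) / 2) * Complex.exp (-(t : ℂ) / 2)
  else (lam1 r * Complex.exp (lam2 r * t) - lam2 r * Complex.exp (lam1 r * t)) /
    (lam1 r - lam2 r)

lemma lam_add (r : ℝ) : lam1 r + lam2 r = -1 := by
  unfold lam1 lam2; ring

lemma lam_mul (r : ℝ) : lam1 r * lam2 r = (r : ℂ) ^ 2 := by
  have h := Complex.cpow_nat_inv_pow (1 - 4 * (r : ℂ) ^ 2) (n := 2) (by norm_num)
  simp only [Nat.cast_ofNat] at h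
  unfold lam1 lam2
  linear_combination (-1 / 4 : ℂ) * h

lemma K0_zero (r : ℝ) : K0 0 r = 1 := by
  unfold K0
  split_ifs with h
  · simp
  · have : lam1 r - lam2 r ≠ 0 := sub_ne_zero.mpr h
    simp [this]

lemma K1_zero (r : ℝ) : K1 0 r = 0 := by
  unfold K1
  split_ifs <;> simp

lemma hasDerivAt_exp_mul (a : ℂ) (t : ℝ) :
    HasDerivAt (fun s : ℝ => Complex.exp (a * s)) (a * Complex.exp (a * t)) t := by
  have h : HasDerivAt (fun s : ℝ => a * (s : ℂ)) (a * 1) t :=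
    (Complex.ofRealCLM.hasDerivAt (x := t)).const_mul a
  simpa [mul_comm] using h.cexp

/-- `K₀' = -r² K₁`. With `hasDerivAt_K1` this gives `K'' + K' + r² K = 0` for `K = K₀, K₁`, and
with `K0_zero`, `K1_zero` the initial data `(1, 0)` and `(0, 1)`. -/
lemma hasDerivAt_K0 (t r : ℝ) :
    HasDerivAt (fun s : ℝ => K0 s r) (-(r : ℂ) ^ 2 * K1 t r) t := by
  have hs := lam_add r
  have hm := lam_mul r
  by_cases h : lam1 r = lam2 r
  · have h2 : lam2 r = -1 / 2 := by rw [h] at hs; linear_combination hs / 2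
    have hr : (r : ℂ) ^ 2 = 1 / 4 := by rw [← hm, h, h2]; ring
    simp only [K0, K1, h, if_true]
    have he := hasDerivAt_exp_mul (-1 / 2) t
    have hl : HasDerivAt (fun s : ℝ => 1 + (s : ℂ) / 2) (1 / 2) t := by
      simpa using ((Complex.ofRealCLM.hasDerivAt (x := t)).div_const 2).const_add 1
    have := hl.mul he
    have e : ∀ s : ℝ, (-1 / 2 : ℂ) * s = -(s : ℂ) / 2 := fun s => by ring
    simp only [e] at this
    convert! this using 1
    rw [hr]; ring
  · have hd : lam1 r - lam2 r ≠ 0 := sub_ne_zero.mpr h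
    simp only [K0, K1, h, if_false]
    have := (((hasDerivAt_exp_mul (lam2 r) t).const_mul (lam1 r)).sub
      ((hasDerivAt_exp_mul (lam1 r) t).const_mul (lam2 r))).div_const (lam1 r - lam2 r)
    convert! this using 1
    rw [← hm]; field_simp; ring

/-- `K₁' = K₀ - K₁`. -/
lemma hasDerivAt_K1 (t r : ℝ) :
    HasDerivAt (fun s : ℝ => K1 s r) (K0 t r - K1 t r) t := by
  have hs := lam_add r
  by_cases h : lam1 r = lam2 r
  · simp only [K0, K1, h, if_true]
    have he := hasDerivAt_exp_mul (-1 / 2) t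
    have hl : HasDerivAt (fun s : ℝ => (s : ℂ)) 1 t := Complex.ofRealCLM.hasDerivAt (x := t)
    have := hl.mul he
    have e : ∀ s : ℝ, (-1 / 2 : ℂ) * s = -(s : ℂ) / 2 := fun s => by ring
    simp only [e] at this
    convert! this using 1
    ring
  · have hd : lam1 r - lam2 r ≠ 0 := sub_ne_zero.mpr h
    simp only [K0, K1, h, if_false]
    have := ((hasDerivAt_exp_mul (lam1 r) t).sub
      (hasDerivAt_exp_mul (lam2 r) t)).div_const (lam1 r - lam2 r)
    convert! this using 1
    rw [← sub_div]
    congr 1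
    linear_combination (Complex.exp (lam2 r * t) - Complex.exp (lam1 r * t)) * hs

lemma measurable_lam1 : Measurable lam1 := by
  unfold lam1; fun_prop

lemma measurable_lam2 : Measurable lam2 := by
  unfold lam2; fun_prop

lemma measurable_K1 (t : ℝ) : Measurable (K1 t) := by
  have h1 := measurable_lam1
  have h2 := measurable_lam2
  unfold K1
  exact Measurable.ite (measurableSet_eq_fun h1 h2) (by fun_prop) (by fun_prop)

lemma measurable_K0 (t : ℝ) : Measurable (K0 t) := by
  have h1 := measurable_lam1
  have h2 := measurable_lam2
  unfold K0
  exact Measurable.ite (measurableSet_eq_fun h1 h2) (by fun_prop) (by fun_prop)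

lemma abs_re_lam (r : ℝ) : |(lam1 r).re| ≤ 1 ∧ |(lam2 r).re| ≤ 1 := by
  have h := Complex.cpow_nat_inv_pow (1 - 4 * (r : ℂ) ^ 2) (n := 2) (by norm_num)
  simp only [Nat.cast_ofNat] at h
  unfold lam1 lam2
  set s : ℂ := (1 - 4 * (r : ℂ) ^ 2) ^ ((2 : ℂ)⁻¹)
  have hre := congrArg Complex.re h
  have him := congrArg Complex.im h
  simp [pow_two] at hre him
  have hs : |s.re| ≤ 1 := by
    rw [abs_le]
    by_cases h0 : s.re = 0
    · rw [h0]; norm_num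
    · have hi : s.im = 0 := by
        have : s.re * s.im = 0 := by linarith
        exact (mul_eq_zero.mp this).resolve_left h0
      rw [hi] at hre
      constructor <;> nlinarith [mul_self_nonneg r]
  rw [abs_le] at hs
  constructor <;> · simp; rw [abs_le]; constructor <;> linarith [hs.1, hs.2]

lemma norm_exp_le (t : ℝ) {w : ℂ} (hw : |w.re| ≤ 1) :
    ‖Complex.exp (w * t)‖ ≤ Real.exp |t| := by
  rw [Complex.norm_exp]
  apply Real.exp_le_exp.mpr
  simp only [Complex.mul_re, Complex.ofReal_re, Complex.ofReal_im, mul_zero, sub_zero]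
  calc w.re * t ≤ |w.re * t| := le_abs_self _
    _ = |w.re| * |t| := abs_mul _ _
    _ ≤ 1 * |t| := by gcongr
    _ = |t| := one_mul _

lemma norm_K1_le (t r : ℝ) : ‖K1 t r‖ ≤ |t| * Real.exp |t| := by
  obtain ⟨h1, h2⟩ := abs_re_lam r
  unfold K1
  split_ifs with h
  · have := norm_exp_le t (w := -1 / 2) (by norm_num)
    have e : (-1 / 2 : ℂ) * t = -(t : ℂ) / 2 := by ring
    rw [e] at this
    simp only [norm_mul, Complex.norm_real, Real.norm_eq_abs]
    gcongr
  · have hd : lam1 r - lam2 r ≠ 0 := sub_ne_zero.mpr h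
    rw [norm_div, div_le_iff₀ (norm_pos_iff.mpr hd)]
    have hc : Convex ℝ {w : ℂ | |w.re| ≤ 1} := by
      have : {w : ℂ | |w.re| ≤ 1} = Complex.reLm ⁻¹' (Icc (-1) 1) := by
        ext w; simp [abs_le]
      rw [this]
      exact (convex_Icc (-1 : ℝ) 1).linear_preimage _
    refine hc.norm_image_sub_le_of_norm_hasDerivWithin_le
      (f := fun w : ℂ => Complex.exp (w * t)) (f' := fun w => Complex.exp (w * t) * t)
      (fun w _ => ?_) (fun w hw => ?_) h2 h1
    · have : HasDerivAt (fun w : ℂ => w * (t : ℂ)) (t : ℂ) w := by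
        simpa using (hasDerivAt_id w).mul_const (t : ℂ)
      exact this.cexp.hasDerivWithinAt
    · rw [norm_mul, mul_comm, Complex.norm_real, Real.norm_eq_abs]
      gcongr
      exact norm_exp_le t hw

lemma norm_K0_le (t r : ℝ) : ‖K0 t r‖ ≤ (1 + |t|) * Real.exp |t| := by
  obtain ⟨h1, h2⟩ := abs_re_lam r
  have hs := lam_add r
  have key : K0 t r =
      (Complex.exp (lam1 r * t) + Complex.exp (lam2 r * t)) / 2 + K1 t r / 2 := by
    unfold K0 K1
    split_ifs with h
    · have e2 : lam2 r = -1 / 2 := by rw [h] at hs; linear_combination hs / 2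
      have e : (-1 / 2 : ℂ) * t = -(t : ℂ) / 2 := by ring
      rw [h, e2, e]; ring
    · have hd : lam1 r - lam2 r ≠ 0 := sub_ne_zero.mpr h
      field_simp
      linear_combination (Complex.exp (lam2 r * t) - Complex.exp (lam1 r * t)) * hs
  have b1 := norm_exp_le t h1
  have b2 := norm_exp_le t h2
  have b3 := norm_K1_le t r
  rw [key]
  refine (norm_add_le _ _).trans ?_
  rw [norm_div, norm_div, Complex.norm_ofNat]
  have := norm_add_le (Complex.exp (lam1 r * t)) (Complex.exp (lam2 r * t))
  have : 0 ≤ |t| * Real.exp |t| := by positivity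
  linarith

/-- A bounded measurable radial symbol maps `L²` into itself. -/
lemma memLp_radial_mul {n : ℕ} {m : ℝ → ℂ} (hm : Measurable m) {C : ℝ} (hC : ∀ r, ‖m r‖ ≤ C)
    (f : L2 n) :
    MemLp (fun ξ : Rn n => m (2 * Real.pi * ‖ξ‖) * f ξ) 2 volume := by
  refine MemLp.of_le_mul (c := C) (Lp.memLp f) ?_ (Eventually.of_forall fun ξ => ?_)
  · have : Measurable (fun ξ : Rn n => m (2 * Real.pi * ‖ξ‖)) := hm.comp (by fun_prop)
    exact this.aestronglyMeasurable.mul (Lp.aestronglyMeasurable f)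
  · rw [norm_mul]
    gcongr
    exact hC _

/-- `E₀(t) ∗ f`, the convolution in space, which is the multiplication of `f̂` by the Fourier
transform of `E₀(t)`. -/
def E0 {n : ℕ} (t : ℝ) (f : L2 n) : L2 n :=
  𝓕⁻ ((memLp_radial_mul (measurable_K0 t) (norm_K0_le t) (𝓕 f : L2 n)).toLp _ : L2 n)

/-- `E₁(t) ∗ f`, the convolution in space. -/
def E1 {n : ℕ} (t : ℝ) (f : L2 n) : L2 n :=
  𝓕⁻ ((memLp_radial_mul (measurable_K1 t) (norm_K1_le t) (𝓕 f : L2 n)).toLp _ : L2 n)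

/-! ### Mild solutions and their lifespan -/

/-- `u ∈ 𝒞([0, T), H¹)`; the values of `u` outside of `[0, T)` are irrelevant. -/
def IsContinuousInH1 {n : ℕ} (T : ℝ) (u : ℝ → L2 n) : Prop :=
  ∀ t ∈ Ico 0 T, sobolevNorm 1 (u t) < ∞ ∧
    Tendsto (fun s => sobolevNorm 1 (u s - u t)) (𝓝[Ico 0 T] t) (𝓝 0)

/-- `u` is a mild solution on `[0, T)` of `u_tt - Δu + u_t = |u|^p`, `(u, u_t)(0) = ε (u₀, u₁)`:
it belongs to `𝒞([0, T), H¹)` and satisfies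
`u(t) = ε E₀(t) ∗ u₀ + ε E₁(t) ∗ u₁ + ∫₀ᵗ E₁(t - τ) ∗ |u(τ)|^p dτ` for `t ∈ [0, T)`.
Here `g τ` is the function `|u(τ)|^p` as an element of `L²`, and the integral is that of an
integrable function with values in `L²`. -/
def IsMildSolution {n : ℕ} (p ε T : ℝ) (u₀ u₁ : L2 n) (u : ℝ → L2 n) : Prop :=
  IsContinuousInH1 T u ∧
  ∃ g : ℝ → L2 n,
    (∀ τ ∈ Ico 0 T, ∀ᵐ x, g τ x = ((‖u τ x‖ ^ p : ℝ) : ℂ)) ∧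
    ∀ t ∈ Ico 0 T,
      IntervalIntegrable (fun τ => E1 (t - τ) (g τ)) volume 0 t ∧
      u t = (ε : ℂ) • E0 t u₀ + (ε : ℂ) • E1 t u₁ + ∫ τ in (0 : ℝ)..t, E1 (t - τ) (g τ)

/-- There is a unique mild solution on `[0, T)`. -/
def ExistsUniqueMild {n : ℕ} (p ε T : ℝ) (u₀ u₁ : L2 n) : Prop :=
  ∃ u, IsMildSolution p ε T u₀ u₁ u ∧
    ∀ v, IsMildSolution p ε T u₀ u₁ v → ∀ t ∈ Ico 0 T, v t = u t

/-- The lifespan `T_{ε,m} ∈ [0, ∞]` of the mild solution: the supremum of the `T > 0` such that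
there is a unique mild solution on `[0, T)`. -/
def lifespan {n : ℕ} (p ε : ℝ) (u₀ u₁ : L2 n) : ℝ≥0∞ :=
  sSup (ENNReal.ofReal '' {T : ℝ | 0 < T ∧ ExistsUniqueMild p ε T u₀ u₁})

/-- The critical exponent `1 + 4 / (n + 2γ)`. -/
def pCrit (n : ℕ) (γ : ℝ) : ℝ := 1 + 4 / (n + 2 * γ)

end DampedWave

end

noncomputable section

namespace DampedWave

/-- The inverse Fourier transform on `L²` of an integrable function is its inverse Fourier
integral. -/
theorem fourierInv_ae_eq_integral {n : ℕ} (f : L2 n) (hf : Integrable f) :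
    (𝓕⁻ f : L2 n) =ᵐ[volume] 𝓕⁻ (f : Rn n → ℂ) := by
  have hc : Continuous (𝓕⁻ (f : Rn n → ℂ)) :=
    VectorFourier.fourierIntegral_continuous (L := -innerₗ (Rn n)) Real.continuous_fourierChar
      (by simpa using (continuous_inner (𝕜 := ℝ)).fun_neg) hf
  refine ae_eq_of_integral_contDiff_smul_eq
    ((Lp.memLp _).locallyIntegrable (by norm_num)) hc.locallyIntegrable fun g hg1 hg2 => ?_
  have h2 : HasCompactSupport (Complex.ofRealCLM ∘ g) := hg2.comp_left rfl
  set G := h2.toSchwartzMap (Complex.ofRealCLM.contDiff.comp hg1) with hG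
  have hGv : ∀ x, G x = (g x : ℂ) := fun x => rfl
  -- As tempered distributions, the `L²` transform is moved onto the test function; Fubini moves the
  -- integral transform in the same way, so both sides have the same pairings.
  have h := congrArg (fun T => T G) (Lp.fourierInv_toTemperedDistribution_eq f)
  simp only [TemperedDistribution.fourierInv_apply, Lp.toTemperedDistribution_apply] at h
  have e := VectorFourier.integral_fourierIntegral_smul_eq_flip (L := -innerₗ (Rn n))
    (μ := volume) (ν := volume) Real.continuous_fourierChar
      (by simpa using (continuous_inner (𝕜 := ℝ)).fun_neg) (G.integrable) hf
  have e1 : ∀ x, (𝓕⁻ G) x = VectorFourier.fourierIntegral 𝐞 volume (-innerₗ (Rn n)) (G : Rn n → ℂ) x := by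
    intro x
    rw [SchwartzMap.fourierInv_coe]
    rfl
  have e2 : (-innerₗ (Rn n)).flip = -innerₗ (Rn n) := by
    ext x y; simp [real_inner_comm]
  simp only [e1] at h
  rw [e, e2] at h
  simp only [hGv] at h
  simp only [Complex.real_smul]
  exact h.symm

theorem norm_fourierInv_le_integral {n : ℕ} (f : L2 n) (hf : Integrable f) :
    ∀ᵐ x, ‖(𝓕⁻ f : L2 n) x‖ ≤ ∫ ξ, ‖f ξ‖ := by
  filter_upwards [fourierInv_ae_eq_integral f hf] with x hx
  rw [hx]
  exact VectorFourier.norm_fourierIntegral_le_integral_norm _ _ (-innerₗ (Rn n)) _ _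

/-- The mass of the power `‖ξ‖^{-a}` on a ball, by scaling. -/
theorem setLIntegral_ball_norm_rpow {n : ℕ} (hn : 1 ≤ n) {a : ℝ} (ha : a < n) :
    ∃ K : ℝ, 0 < K ∧ ∀ A : ℝ, 0 < A →
      ∫⁻ ξ in Metric.ball (0 : Rn n) A, ENNReal.ofReal (‖ξ‖ ^ (-a)) ≤
        ENNReal.ofReal (K * A ^ (n - a)) := by
  have hI : IntegrableOn (fun ξ : Rn n => ‖ξ‖ ^ (-a)) (Metric.ball 0 1) := by
    refine integrableOn_ball_of_norm_le_rpow (C := 1) (α := a) (by simpa using hn)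
      (by simpa using ha) (.of_forall fun x => ?_)
      (measurable_norm.pow_const _).aestronglyMeasurable
    simp [abs_of_nonneg (Real.rpow_nonneg (norm_nonneg x) _)]
  -- The mass of the unit ball is the sharp constant; the added 1 only makes positivity immediate.
  refine ⟨(∫ ξ in Metric.ball (0 : Rn n) 1, ‖ξ‖ ^ (-a)) + 1, by positivity, fun A hA => ?_⟩
  have hsc := Measure.setIntegral_comp_smul (volume : Measure (Rn n))
    (fun ξ : Rn n => ‖ξ‖ ^ (-a)) (Metric.ball (0 : Rn n) 1) hA.ne'
  have hIA : IntegrableOn (fun ξ : Rn n => ‖ξ‖ ^ (-a)) (Metric.ball 0 A) := by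
    refine integrableOn_ball_of_norm_le_rpow (C := 1) (α := a) (by simpa using hn)
      (by simpa using ha) (.of_forall fun x => ?_)
      (measurable_norm.pow_const _).aestronglyMeasurable
    simp [abs_of_nonneg (Real.rpow_nonneg (norm_nonneg x) _)]
  rw [← ofReal_integral_eq_lintegral_ofReal hIA (.of_forall fun x => by positivity)]
  apply ENNReal.ofReal_le_ofReal
  rw [smul_unitBall_of_pos hA] at hsc
  simp only [norm_smul, Real.norm_eq_abs, abs_of_pos hA,
    Real.mul_rpow hA.le (norm_nonneg _), integral_const_mul, finrank_euclideanSpace,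
    Fintype.card_fin, smul_eq_mul] at hsc
  have hAn : (0:ℝ) < A ^ n := by positivity
  rw [abs_of_pos (by positivity), eq_inv_mul_iff_mul_eq₀ hAn.ne'] at hsc
  rw [← hsc]
  have : A ^ (n - a) = A ^ n * A ^ (-a) := by
    rw [← Real.rpow_natCast, ← Real.rpow_add hA]; rfl
  rw [this]
  have : 0 < A ^ n * A ^ (-a) := by positivity
  nlinarith

/-- Cauchy–Schwarz against ‖ξ‖^{-s} on the ball, whose square has mass of order A^{n-2s}, finite
because 2s < n. -/
theorem eLpNorm_one_indicator_ball_le {n : ℕ} (hn : 1 ≤ n) {s : ℝ} (hs : s < n / 2) :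
    ∃ K : ℝ, 0 < K ∧ ∀ A : ℝ, 0 < A → ∀ F : L2 n,
      eLpNorm ((Metric.ball (0 : Rn n) A).indicator F) 1 ≤
        ENNReal.ofReal (K * A ^ (n / 2 - s)) *
          eLpNorm (fun ξ : Rn n => ((‖ξ‖ ^ s : ℝ) : ℂ) * F ξ) 2 := by
  obtain ⟨K, hK, h⟩ := setLIntegral_ball_norm_rpow hn (a := 2 * s) (by linarith)
  refine ⟨√K, by positivity, fun A hA F => ?_⟩
  set φ : Rn n → ℂ := (Metric.ball (0 : Rn n) A).indicator fun ξ => ((‖ξ‖ ^ (-s) : ℝ) : ℂ) with hφ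
  have hφm : AEStronglyMeasurable φ volume :=
    AEStronglyMeasurable.indicator
      (Complex.measurable_ofReal.comp (measurable_norm.pow_const _)).aestronglyMeasurable
      measurableSet_ball
  have hFm : AEStronglyMeasurable (fun ξ : Rn n => ((‖ξ‖ ^ s : ℝ) : ℂ) * F ξ) volume :=
    (Complex.measurable_ofReal.comp (measurable_norm.pow_const _)).aestronglyMeasurable.mul
      (Lp.aestronglyMeasurable F)
  have h1 : eLpNorm ((Metric.ball (0 : Rn n) A).indicator F) 1 volume ≤
      eLpNorm (φ • fun ξ : Rn n => ((‖ξ‖ ^ s : ℝ) : ℂ) * F ξ) 1 volume := by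
    refine (eLpNorm_congr_ae ?_).le
    have : Nontrivial (Rn n) := by
      have : Nonempty (Fin n) := ⟨⟨0, hn⟩⟩
      infer_instance
    filter_upwards [(measure_eq_zero_iff_ae_notMem.1 (measure_singleton (0 : Rn n)))] with ξ hξ
    have hξ' : 0 < ‖ξ‖ := norm_pos_iff.2 hξ
    by_cases hb : ξ ∈ Metric.ball (0 : Rn n) A
    · simp only [hφ, indicator_of_mem hb, Pi.smul_apply', smul_eq_mul, ← mul_assoc]
      rw [← Complex.ofReal_mul, ← Real.rpow_add hξ']
      simp
    · simp [hφ, indicator_of_notMem hb]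
  refine h1.trans ((eLpNorm_smul_le_mul_eLpNorm (p := 2) (q := 2) (r := 1) hFm hφm).trans ?_)
  gcongr
  rw [eLpNorm_eq_lintegral_rpow_enorm_toReal (by norm_num) (by norm_num)]
  have e : ∀ ξ : Rn n, ‖φ ξ‖ₑ ^ (2 : ℝ) = (Metric.ball (0 : Rn n) A).indicator
      (fun ξ => ENNReal.ofReal (‖ξ‖ ^ (-(2 * s)))) ξ := by
    intro ξ
    by_cases hb : ξ ∈ Metric.ball (0 : Rn n) A
    · simp only [hφ, indicator_of_mem hb]
      rw [← ofReal_norm, Complex.norm_real, Real.norm_eq_abs,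
        abs_of_nonneg (by positivity), ENNReal.ofReal_rpow_of_nonneg (by positivity) (by norm_num),
        ← Real.rpow_mul (norm_nonneg _)]
      ring_nf
    · simp [hφ, indicator_of_notMem hb]
  simp only [ENNReal.toReal_ofNat, e]
  rw [lintegral_indicator measurableSet_ball]
  refine (ENNReal.rpow_le_rpow (h A hA) (by norm_num)).trans ?_
  rw [ENNReal.ofReal_rpow_of_nonneg (by positivity) (by norm_num)]
  apply ENNReal.ofReal_le_ofReal
  rw [Real.mul_rpow hK.le (by positivity), ← Real.rpow_mul hA.le, ← Real.sqrt_eq_rpow]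
  apply le_of_eq
  ring_nf

/-- Chebyshev's inequality for the high frequencies, when the low frequencies are small in
`L^∞`. -/
theorem meas_norm_gt_le_lintegral_fourier {n : ℕ} {A l : ℝ} (hl : 0 < l) (f : L2 n)
    (h : eLpNorm ((Metric.ball (0 : Rn n) A).indicator (𝓕 f : L2 n)) 1 ≤ ENNReal.ofReal (l / 2)) :
    volume {x | l < ‖f x‖} ≤ ENNReal.ofReal (4 / l ^ 2) *
      ∫⁻ ξ in (Metric.ball (0 : Rn n) A)ᶜ, ‖(𝓕 f : L2 n) ξ‖ₑ ^ (2 : ℝ) := by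
  set F : L2 n := 𝓕 f with hF
  set B := Metric.ball (0 : Rn n) A
  have hB : MeasurableSet B := measurableSet_ball
  have hlo : MemLp (B.indicator F) 2 volume := (Lp.memLp F).indicator hB
  have hhi : MemLp (Bᶜ.indicator F) 2 volume := (Lp.memLp F).indicator hB.compl
  set lo : L2 n := hlo.toLp _
  set hi : L2 n := hhi.toLp _
  have hsum : lo + hi = F := by
    apply Lp.ext
    filter_upwards [Lp.coeFn_add lo hi, hlo.coeFn_toLp, hhi.coeFn_toLp] with ξ h1 h2 h3
    rw [h1, Pi.add_apply, h2, h3, Set.indicator_self_add_compl_apply]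
  have hf : f = (𝓕⁻ lo : L2 n) + 𝓕⁻ hi := by
    rw [← FourierTransform.fourierInv_add, hsum, hF, FourierTransform.fourierInv_fourier_eq]
  have hloint : Integrable lo := by
    rw [← memLp_one_iff_integrable]
    refine ⟨Lp.aestronglyMeasurable _, ?_⟩
    rw [eLpNorm_congr_ae hlo.coeFn_toLp]
    exact h.trans_lt ENNReal.ofReal_lt_top
  have hbd : ∫ ξ, ‖lo ξ‖ ≤ l / 2 := by
    rw [integral_norm_eq_lintegral_enorm hloint.1, ← eLpNorm_one_eq_lintegral_enorm,
      eLpNorm_congr_ae hlo.coeFn_toLp]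
    exact ENNReal.toReal_le_of_le_ofReal (by positivity) h
  -- The low-frequency part is at most l/2 pointwise, so where |f| exceeds l the high-frequency part
  -- is at least l/2.
  have hsub : volume {x | l < ‖f x‖} ≤ volume {x | ENNReal.ofReal (l / 2) ≤ ‖(𝓕⁻ hi : L2 n) x‖ₑ} := by
    apply measure_mono_ae
    filter_upwards [Lp.coeFn_add (𝓕⁻ lo : L2 n) (𝓕⁻ hi), norm_fourierInv_le_integral lo hloint]
      with x h1 h2 hx
    change l < ‖f x‖ at hx
    change ENNReal.ofReal (l / 2) ≤ ‖(𝓕⁻ hi : L2 n) x‖ₑ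
    rw [hf, h1, Pi.add_apply] at hx
    rw [← ofReal_norm]
    apply ENNReal.ofReal_le_ofReal
    have := norm_add_le ((𝓕⁻ lo : L2 n) x) ((𝓕⁻ hi : L2 n) x)
    linarith
  have hl2 : ENNReal.ofReal (l / 2) ≠ 0 := by simpa using hl
  refine hsub.trans ((meas_ge_le_mul_pow_eLpNorm_enorm (p := 2) volume (by norm_num) (by norm_num)
    (Lp.aestronglyMeasurable _) hl2 (by simp)).trans ?_)
  have e1 : eLpNorm (𝓕⁻ hi : L2 n) 2 volume = eLpNorm (Bᶜ.indicator F) 2 volume := by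
    rw [← eLpNorm_congr_ae hhi.coeFn_toLp, ← Lp.enorm_def, ← Lp.enorm_def, ← ofReal_norm,
      ← ofReal_norm, ← Lp.norm_fourier_eq, FourierTransform.fourier_fourierInv_eq]
  rw [e1, eLpNorm_eq_lintegral_rpow_enorm_toReal (by norm_num) (by norm_num), ← ENNReal.rpow_mul]
  have e2 : ∀ ξ, ‖Bᶜ.indicator F ξ‖ₑ ^ (2 : ℝ) = Bᶜ.indicator (fun ξ => ‖F ξ‖ₑ ^ (2 : ℝ)) ξ := by
    intro ξ
    by_cases hb : ξ ∈ Bᶜ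
    · simp only [indicator_of_mem hb]
    · simp only [indicator_of_notMem hb]; simp
  simp only [ENNReal.toReal_ofNat, e2]
  rw [lintegral_indicator hB.compl]
  norm_num
  gcongr
  rw [← ENNReal.ofReal_inv_of_pos (by positivity), ← ENNReal.ofReal_pow (by positivity)]
  apply ENNReal.ofReal_le_ofReal
  apply le_of_eq
  field_simp
  norm_num

/-- The Sobolev embedding `Ḣ^s ⊂ L^q`, `s = n (1/2 - 1/q) ∈ (0, n/2)`, for functions in `L²`. -/
theorem sobolev_embedding {n : ℕ} (hn : 1 ≤ n) {s q : ℝ} (hq : 2 < q)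
    (hs : s = n * (1 / 2 - 1 / q)) :
    ∃ C : ℝ, 0 < C ∧ ∀ f : L2 n, eLpNorm f (ENNReal.ofReal q) ≤
      ENNReal.ofReal C * eLpNorm (fun ξ : Rn n => ((‖ξ‖ ^ s : ℝ) : ℂ) * (𝓕 f : L2 n) ξ) 2 := by
  have hn0 : (0 : ℝ) < n := by exact_mod_cast hn
  have hq0 : 0 < q := by linarith
  have hs2 : s < n / 2 := by
    rw [hs]
    have : 0 < (n : ℝ) * (1 / q) := by positivity
    linarith
  obtain ⟨K, hK, hKb⟩ := eLpNorm_one_indicator_ball_le hn hs2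
  -- The factor q comes from the layer-cake formula, 4/(q - 2) from integrating 4 l^{q-3} up to a
  -- threshold, and (2K)^{q-2} from the threshold itself.
  set D : ℝ := 4 * q / (q - 2) * (2 * K) ^ (q - 2) with hD
  have hDpos : 0 < D := by have : 0 < q - 2 := by linarith
                           positivity
  refine ⟨D ^ (1 / q), by positivity, fun f => ?_⟩
  set F : L2 n := 𝓕 f with hF
  set W : Rn n → ℂ := fun ξ => ((‖ξ‖ ^ s : ℝ) : ℂ) * F ξ with hW
  have hWm : AEStronglyMeasurable W volume :=
    (Complex.measurable_ofReal.comp (measurable_norm.pow_const _)).aestronglyMeasurable.mul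
      (Lp.aestronglyMeasurable F)
  by_cases htop : eLpNorm W 2 volume = ∞
  · rw [htop, ENNReal.mul_top (by positivity)]; exact le_top
  obtain ⟨a, hann, ha'⟩ : ∃ a : ℝ, 0 ≤ a ∧ eLpNorm W 2 volume = ENNReal.ofReal a :=
    ⟨_, ENNReal.toReal_nonneg, (ENNReal.ofReal_toReal htop).symm⟩
  have hNT : Nontrivial (Rn n) := by
    have : Nonempty (Fin n) := ⟨⟨0, hn⟩⟩
    infer_instance
  have hne : ∀ᵐ ξ : Rn n, ξ ∉ ({0} : Set (Rn n)) :=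
    measure_eq_zero_iff_ae_notMem.1 (measure_singleton (0 : Rn n))
  -- The degenerate case is separate because the frequency cutoff below divides by a.
  rcases hann.eq_or_lt with ha0 | ha0
  · have hz : eLpNorm W 2 volume = 0 := by rw [ha', ← ha0]; simp
    rw [eLpNorm_eq_zero_iff hWm (by norm_num)] at hz
    have hF0 : F = 0 := by
      apply Lp.ext
      filter_upwards [hz, hne, Lp.coeFn_zero ℂ 2 (volume : Measure (Rn n))] with ξ h1 h2 h3
      rw [h3]
      have h2' : ‖ξ‖ ^ s ≠ 0 := (Real.rpow_pos_of_pos (norm_pos_iff.2 h2) _).ne'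
      simpa [hW, h2'] using h1
    have hf0 : f = 0 := by
      rw [← FourierTransform.fourierInv_fourier_eq (E := L2 n) (F := L2 n) f, ← hF, hF0]
      exact (Lp.fourierTransformₗᵢ (Rn n) ℂ).symm.map_zero
    rw [hf0, eLpNorm_congr_ae (Lp.coeFn_zero ℂ 2 (volume : Measure (Rn n)))]
    simp
  -- The cutoff radius will depend on the level l; ξ counts as a high frequency exactly for levels l
  -- ≤ Λ ξ.
  · set Λ : Rn n → ℝ := fun ξ => 2 * K * a * ‖ξ‖ ^ (n / q) with hΛ
    have hΛm : Measurable Λ := by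
      exact (measurable_norm.pow_const _).const_mul _
    have hexp : (n : ℝ) / 2 - s = n / q := by rw [hs]; field_simp; ring
    have hlev : ∀ l : ℝ, 0 < l → volume {x | l < ‖f x‖} ≤ ENNReal.ofReal (4 / l ^ 2) *
        ∫⁻ ξ in {ξ | l ≤ Λ ξ}, ‖F ξ‖ₑ ^ (2 : ℝ) := by
      intro l hl
      -- Chosen so that K A^{n/q} a = l/2, the smallness of the low frequencies required by the
      -- Chebyshev estimate.
      set A : ℝ := (l / (2 * K * a)) ^ (q / n) with hA
      have hApos : 0 < A := by positivity
      have hAn : A ^ (n / q) = l / (2 * K * a) := by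
        rw [hA, ← Real.rpow_mul (by positivity)]
        rw [show q / n * (n / q) = 1 by field_simp, Real.rpow_one]
      have h1 := meas_norm_gt_le_lintegral_fourier (A := A) hl f (by
        refine (hKb A hApos F).trans ?_
        rw [← hW, ha', ← ENNReal.ofReal_mul (by positivity), hexp, hAn]
        apply ENNReal.ofReal_le_ofReal
        apply le_of_eq
        field_simp)
      refine h1.trans ?_
      gcongr
      intro ξ hξ
      simp only [mem_compl_iff, Metric.mem_ball, dist_zero_right, not_lt] at hξ
      have := Real.rpow_le_rpow hApos.le hξ (by positivity : (0:ℝ) ≤ n / q)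
      rw [hAn, div_le_iff₀ (by positivity)] at this
      simp only [hΛ, mem_ofPred_eq]
      linarith
    have hlay := lintegral_rpow_eq_lintegral_meas_lt_mul (volume : Measure (Rn n))
      (f := fun x => ‖f x‖) (.of_forall fun x => norm_nonneg _)
      (Lp.aestronglyMeasurable f).norm.aemeasurable hq0
    have hFm : Measurable (fun ξ => F ξ) := (Lp.stronglyMeasurable F).measurable
    have hint : ∀ L : ℝ, 0 ≤ L → ∫⁻ l in Ioi (0 : ℝ), ENNReal.ofReal (4 * l ^ (q - 3)) *
        (if l ≤ L then 1 else 0) ≤ ENNReal.ofReal (4 / (q - 2) * L ^ (q - 2)) := by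
      intro L hL
      have e : ∫⁻ l in Ioi (0 : ℝ), ENNReal.ofReal (4 * l ^ (q - 3)) * (if l ≤ L then 1 else 0)
          = ∫⁻ l in Ioc (0 : ℝ) L, ENNReal.ofReal (4 * l ^ (q - 3)) := by
        rw [← lintegral_indicator measurableSet_Ioi, ← lintegral_indicator measurableSet_Ioc]
        congr 1 with l
        by_cases h1 : 0 < l <;> by_cases h2 : l ≤ L <;> simp [indicator, h1, h2]
      rw [e]
      have hII : IntervalIntegrable (fun l : ℝ => 4 * l ^ (q - 3)) volume 0 L :=
        (intervalIntegral.intervalIntegrable_rpow' (by linarith)).const_mul 4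
      rw [intervalIntegrable_iff_integrableOn_Ioc_of_le hL] at hII
      rw [← ofReal_integral_eq_lintegral_ofReal hII
        ((ae_restrict_iff' measurableSet_Ioc).2 (.of_forall fun l hl => by
          have := hl.1
          positivity)), ← intervalIntegral.integral_of_le hL,
        intervalIntegral.integral_const_mul, integral_rpow (.inl (by linarith))]
      apply ENNReal.ofReal_le_ofReal
      rw [show q - 3 + 1 = q - 2 by ring, Real.zero_rpow (by linarith)]
      apply le_of_eq; ring
    have hmain : ∫⁻ x, ENNReal.ofReal (‖f x‖ ^ q) ≤
        ENNReal.ofReal (D * a ^ q) := by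
      rw [hlay]
      calc ENNReal.ofReal q * ∫⁻ l in Ioi (0 : ℝ), volume {x | l < ‖f x‖} * ENNReal.ofReal (l ^ (q - 1))
          ≤ ENNReal.ofReal q * ∫⁻ l in Ioi (0 : ℝ), ∫⁻ ξ, ENNReal.ofReal (4 * l ^ (q - 3)) *
              (if l ≤ Λ ξ then 1 else 0) * ‖F ξ‖ₑ ^ (2 : ℝ) := by
            refine mul_le_mul' le_rfl ?_
            refine setLIntegral_mono' measurableSet_Ioi fun l hl => ?_
            have hl0 : 0 < l := hl
            refine (mul_le_mul_left (hlev l hl) _).trans (le_of_eq ?_)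
            rw [← lintegral_indicator (measurableSet_le measurable_const hΛm), mul_right_comm,
              ← ENNReal.ofReal_mul (by positivity), ← lintegral_const_mul _ (by
                refine Measurable.indicator (by fun_prop) (measurableSet_le measurable_const hΛm))]
            have e3 : 4 / l ^ 2 * l ^ (q - 1) = 4 * l ^ (q - 3) := by
              rw [show q - 3 = (q - 1) - (2 : ℕ) by push_cast; ring, Real.rpow_sub_natCast hl0.ne']
              ring
            rw [e3]
            congr 1 with ξ
            by_cases h2 : l ≤ Λ ξ <;> simp [indicator, h2]
        _ = ENNReal.ofReal q * ∫⁻ ξ, (∫⁻ l in Ioi (0 : ℝ), ENNReal.ofReal (4 * l ^ (q - 3)) *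
              (if l ≤ Λ ξ then 1 else 0)) * ‖F ξ‖ₑ ^ (2 : ℝ) := by
            -- After Tonelli each frequency is integrated over its own levels l ≤ Λ ξ; the power
            -- l^{q-3} is integrable at 0 because q > 2.
            rw [lintegral_lintegral_swap]
            · congr 2 with ξ
              rw [lintegral_mul_const]
              refine Measurable.mul (by fun_prop) ?_
              exact Measurable.ite measurableSet_Iic measurable_const measurable_const
            · refine Measurable.aemeasurable ?_
              refine Measurable.mul (Measurable.mul (by fun_prop) ?_) (by fun_prop)
              exact Measurable.ite (measurableSet_le measurable_fst (hΛm.comp measurable_snd))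
                measurable_const measurable_const
        _ ≤ ENNReal.ofReal q * ∫⁻ ξ, ENNReal.ofReal (4 / (q - 2) * (2 * K * a) ^ (q - 2)) *
              ‖W ξ‖ₑ ^ (2 : ℝ) := by
            refine mul_le_mul' le_rfl ?_
            refine lintegral_mono fun ξ => ?_
            refine (mul_le_mul_left (hint (Λ ξ) (by positivity)) _).trans (le_of_eq ?_)
            -- The scaling relation between s and q enters here: (n/q)(q - 2) = 2s.
            have e4 : (‖ξ‖ ^ (n / q)) ^ (q - 2) = (‖ξ‖ ^ s) ^ (2 : ℝ) := by
              rw [← Real.rpow_mul (norm_nonneg _), ← Real.rpow_mul (norm_nonneg _), hs]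
              congr 1
              field_simp
            simp only [hΛ, hW]
            rw [Real.mul_rpow (by positivity) (by positivity), e4, enorm_mul,
              ENNReal.mul_rpow_of_nonneg _ _ (by norm_num), ← mul_assoc, ← mul_assoc,
              ENNReal.ofReal_mul (by
                have : 0 < q - 2 := by linarith
                positivity)]
            congr 2
            rw [← ofReal_norm, Complex.norm_real, Real.norm_eq_abs,
              abs_of_nonneg (by positivity), ENNReal.ofReal_rpow_of_nonneg (by positivity) (by norm_num)]
        _ = ENNReal.ofReal (D * a ^ q) := by
            have e5 : ∫⁻ ξ, ‖W ξ‖ₑ ^ (2 : ℝ) = ENNReal.ofReal (a ^ 2) := by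
              have := ha'
              rw [eLpNorm_eq_lintegral_rpow_enorm_toReal (by norm_num) (by norm_num)] at this
              simp only [ENNReal.toReal_ofNat] at this
              rw [ENNReal.ofReal_pow ha0.le, ← this, ← ENNReal.rpow_natCast, ← ENNReal.rpow_mul]
              norm_num
            rw [lintegral_const_mul'' _ (hWm.enorm.pow_const _), e5, ← ENNReal.ofReal_mul (by
                have : 0 < q - 2 := by linarith
                positivity), ← ENNReal.ofReal_mul hq0.le]
            congr 1
            have e6 : a ^ q = a ^ (q - 2) * a ^ 2 := by
              rw [← Real.rpow_natCast, ← Real.rpow_add ha0]; norm_num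
            rw [hD, e6, Real.mul_rpow (by positivity) ha0.le]
            ring
    rw [eLpNorm_eq_lintegral_rpow_enorm_toReal (by simpa using hq0) (by simp),
      ENNReal.toReal_ofReal hq0.le, ha', ← ENNReal.ofReal_mul (by positivity)]
    have e7 : D ^ (1 / q) * a = (D * a ^ q) ^ (1 / q) := by
      rw [Real.mul_rpow hDpos.le (by positivity), ← Real.rpow_mul ha0.le]
      field_simp
      simp
    rw [e7, ← ENNReal.ofReal_rpow_of_nonneg (by positivity) (by positivity)]
    gcongr
    refine le_trans (le_of_eq ?_) hmain
    congr 1 with x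
    rw [← ofReal_norm, ENNReal.ofReal_rpow_of_nonneg (norm_nonneg _) hq0.le]

theorem enorm_inner_L2_le {n : ℕ} {m q : ℝ} (hmq : m.HolderConjugate q) (f g : L2 n) :
    ‖(inner ℂ f g : ℂ)‖ₑ ≤ eLpNorm f (ENNReal.ofReal m) * eLpNorm g (ENNReal.ofReal q) := by
  rw [L2.inner_def]
  refine (enorm_integral_le_lintegral_enorm _).trans ?_
  have h := ENNReal.lintegral_mul_le_Lp_mul_Lq (volume : Measure (Rn n)) hmq
    (Lp.aestronglyMeasurable f).enorm (Lp.aestronglyMeasurable g).enorm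
  rw [eLpNorm_eq_lintegral_rpow_enorm_toReal (by simpa using hmq.pos) (by simp),
    eLpNorm_eq_lintegral_rpow_enorm_toReal (by simpa using hmq.symm.pos) (by simp),
    ENNReal.toReal_ofReal hmq.nonneg, ENNReal.toReal_ofReal hmq.symm.nonneg]
  refine le_trans (lintegral_mono fun x => ?_) h
  rw [Pi.mul_apply, ← ofReal_norm, ← ofReal_norm, ← ofReal_norm, ← ENNReal.ofReal_mul (norm_nonneg _)]
  exact ENNReal.ofReal_le_ofReal (norm_inner_le_norm _ _)

/-- The embedding `L^m ⊂ Ḣ^{-γ}`, `1/m = 1/2 + γ/n`, dual to the Sobolev embedding. -/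
theorem eLpNorm_rpow_neg_mul_fourier_le {n : ℕ} (hn : 1 ≤ n) {γ m : ℝ} (hm : 1 < m) (hm2 : m < 2)
    (hγ : γ = n * (1 / m - 1 / 2)) :
    ∃ C : ℝ, 0 < C ∧ ∀ f : L2 n,
      eLpNorm (fun ξ : Rn n => ((‖ξ‖ ^ (-γ) : ℝ) : ℂ) * (𝓕 f : L2 n) ξ) 2 ≤
        ENNReal.ofReal C * eLpNorm f (ENNReal.ofReal m) := by
  have hmq := Real.HolderConjugate.conjExponent hm
  set q := m.conjExponent with hqdef
  have hqi : 1 / q = 1 - 1 / m := by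
    have := hmq.inv_add_inv_eq_one
    simp only [one_div]; linarith
  have hm0 : 0 < m := by linarith
  have hγ0 : 0 ≤ γ := by
    rw [hγ]
    have : 1 / 2 ≤ 1 / m := one_div_le_one_div_of_le hm0 hm2.le
    exact mul_nonneg (Nat.cast_nonneg _) (by linarith)
  have hq2 : 2 < q := by
    have h1 : 1 / 2 < 1 / m := one_div_lt_one_div_of_lt hm0 hm2
    have h2 : 1 / q < 1 / 2 := by linarith
    exact lt_of_one_div_lt_one_div hmq.symm.pos h2
  obtain ⟨C, hC, hS⟩ := sobolev_embedding hn (s := γ) hq2 (by rw [hqi, hγ]; ring)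
  refine ⟨C, hC, fun f => ?_⟩
  set F : L2 n := 𝓕 f with hF
  -- Duality: f is tested against the function with transform ‖ξ‖^{-2γ} F. Removing the ball of
  -- radius δ keeps this function, and the quantity V to be bounded, in `L²`.
  have key : ∀ δ : ℝ, 0 < δ → eLpNorm ({ξ : Rn n | δ < ‖ξ‖}.indicator
      fun ξ : Rn n => ((‖ξ‖ ^ (-γ) : ℝ) : ℂ) * F ξ) 2 ≤
        ENNReal.ofReal C * eLpNorm f (ENNReal.ofReal m) := by
    intro δ hδ
    set U := {ξ : Rn n | δ < ‖ξ‖} with hU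
    have hUm : MeasurableSet U := measurableSet_lt measurable_const measurable_norm
    have hmem : ∀ a : ℝ, 0 ≤ a →
        MemLp (U.indicator fun ξ : Rn n => ((‖ξ‖ ^ (-a) : ℝ) : ℂ) * F ξ) 2 volume := by
      intro a ha
      refine MemLp.of_le_mul (c := δ ^ (-a)) (Lp.memLp F) ?_ (.of_forall fun ξ => ?_)
      · exact (((Complex.measurable_ofReal.comp
          (measurable_norm.pow_const _)).aestronglyMeasurable).mul
          (Lp.aestronglyMeasurable F)).indicator hUm
      · by_cases h : ξ ∈ U
        · rw [indicator_of_mem h, norm_mul, Complex.norm_real, Real.norm_eq_abs,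
            abs_of_nonneg (by positivity)]
          refine mul_le_mul_of_nonneg_right ?_ (norm_nonneg _)
          exact Real.rpow_le_rpow_of_nonpos hδ (le_of_lt h) (by linarith)
        · rw [indicator_of_notMem h, norm_zero]; positivity
    set V : L2 n := (hmem γ hγ0).toLp _ with hV
    set H : L2 n := (hmem (2 * γ) (by linarith)).toLp _ with hH
    have hin : inner ℂ F H = inner ℂ V V := by
      rw [L2.inner_def, L2.inner_def]
      apply integral_congr_ae
      filter_upwards [(hmem γ hγ0).coeFn_toLp, (hmem (2 * γ) (by linarith)).coeFn_toLp]
        with ξ h1 h2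
      rw [h1, h2]
      by_cases h : ξ ∈ U
      · have hξ : 0 < ‖ξ‖ := hδ.trans h
        simp only [indicator_of_mem h]
        have e : ‖ξ‖ ^ (-(2 * γ)) = ‖ξ‖ ^ (-γ) * ‖ξ‖ ^ (-γ) := by
          rw [← Real.rpow_add hξ]; ring_nf
        rw [e]
        simp only [RCLike.inner_apply, map_mul, Complex.conj_ofReal, Complex.ofReal_mul]
        ring
      · simp [indicator_of_notMem h]
    have hphi : 𝓕 (𝓕⁻ H : L2 n) = H := FourierTransform.fourier_fourierInv_eq H
    have h1 := enorm_inner_L2_le hmq f (𝓕⁻ H)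
    have h2 := hS (𝓕⁻ H)
    rw [← Lp.inner_fourier_eq, hphi, ← hF, hin, inner_self_eq_norm_sq_to_K] at h1
    rw [hphi] at h2
    have e3 : eLpNorm (fun ξ : Rn n => ((‖ξ‖ ^ γ : ℝ) : ℂ) * H ξ) 2 = eLpNorm V 2 volume := by
      apply eLpNorm_congr_ae
      filter_upwards [(hmem γ hγ0).coeFn_toLp, (hmem (2 * γ) (by linarith)).coeFn_toLp]
        with ξ h1 h2
      rw [h1, h2]
      by_cases h : ξ ∈ U
      · have hξ : 0 < ‖ξ‖ := hδ.trans h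
        simp only [indicator_of_mem h]
        rw [← mul_assoc, ← Complex.ofReal_mul, ← Real.rpow_add hξ]
        ring_nf
      · simp [indicator_of_notMem h]
    rw [e3] at h2
    have h3 : ENNReal.ofReal ‖V‖ = eLpNorm V 2 volume := by rw [ofReal_norm, Lp.enorm_def]
    rw [← eLpNorm_congr_ae (hmem γ hγ0).coeFn_toLp, ← hV]
    rcases eq_or_ne V 0 with h0 | h0
    · rw [h0, eLpNorm_congr_ae (Lp.coeFn_zero ℂ 2 (volume : Measure (Rn n)))]; simp
    have hVpos : 0 < ‖V‖ := norm_pos_iff.2 h0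
    have h4 : eLpNorm V 2 volume * eLpNorm V 2 volume ≤
        (ENNReal.ofReal C * eLpNorm f (ENNReal.ofReal m)) * eLpNorm V 2 volume := by
      calc _ = ‖((‖V‖ : ℂ)) ^ 2‖ₑ := by
            rw [← h3, ← ENNReal.ofReal_mul (norm_nonneg _), ← ofReal_norm]
            congr 1
            simp [sq]
        _ ≤ _ := h1
        _ ≤ _ := by
          refine (mul_le_mul' le_rfl h2).trans (le_of_eq ?_)
          ring
    -- Pairing, Hölder and Sobolev give ‖V‖² ≤ C ‖f‖_m ‖V‖; one factor cancels because the
    -- truncation made ‖V‖ finite.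
    exact (ENNReal.mul_le_mul_iff_left (by rw [← h3]; simpa using h0)
      (Lp.eLpNorm_ne_top V)).1 h4
  have : Nontrivial (Rn n) := by
    have : Nonempty (Fin n) := ⟨⟨0, hn⟩⟩
    infer_instance
  -- Fatou's lemma along δ = 1/(k + 1) removes the truncation.
  refine (Lp.eLpNorm_lim_le_liminf_eLpNorm (f := fun k : ℕ => {ξ : Rn n | 1 / ((k : ℝ) + 1) < ‖ξ‖}.indicator
      fun ξ : Rn n => ((‖ξ‖ ^ (-γ) : ℝ) : ℂ) * F ξ) (fun k => ?_) _ ?_).trans ?_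
  · exact ((Complex.measurable_ofReal.comp
          (measurable_norm.pow_const _)).aestronglyMeasurable.mul
          (Lp.aestronglyMeasurable F)).indicator (measurableSet_lt measurable_const measurable_norm)
  · filter_upwards [measure_eq_zero_iff_ae_notMem.1 (measure_singleton (0 : Rn n))] with ξ hξ
    have hξ' : 0 < ‖ξ‖ := norm_pos_iff.2 hξ
    apply tendsto_const_nhds.congr'
    filter_upwards [(tendsto_one_div_add_atTop_nhds_zero_nat (𝕜 := ℝ)).eventually_lt_const hξ']
      with k hk
    rw [indicator_of_mem]
    exact hk
  · refine liminf_le_of_frequently_le' (Frequently.of_forall fun k => key _ (by positivity))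

/-! ### Decay of the Fourier symbols `K0` and `K1`. -/

/-- The decay rate of the frequency `r`. -/
def decayRate (r : ℝ) : ℝ := r ^ 2 / (2 * (1 + r ^ 2))

/-- Decay of the energy of `w'' + w' + r² w = 0`, where `v = w' + w / 2`. -/
theorem energy_le {w v : ℝ → ℂ} {r : ℝ} (hw : ∀ t, HasDerivAt w (v t - w t / 2) t)
    (hv : ∀ t, HasDerivAt v (-v t / 2 + w t / 4 - (r : ℂ) ^ 2 * w t) t) {t : ℝ} (ht : 0 ≤ t) :
    (r ^ 2 + 1 / 4) * ‖w t‖ ^ 2 + ‖v t‖ ^ 2 ≤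
      ((r ^ 2 + 1 / 4) * ‖w 0‖ ^ 2 + ‖v 0‖ ^ 2) * Real.exp (-(decayRate r * t)) := by
  have hre : ∀ {f : ℝ → ℂ} {f' : ℂ} {t : ℝ}, HasDerivAt f f' t →
      HasDerivAt (fun t => (f t).re) f'.re t := fun h =>
    (Complex.reCLM.hasFDerivAt.comp_hasDerivAt _ h)
  have him : ∀ {f : ℝ → ℂ} {f' : ℂ} {t : ℝ}, HasDerivAt f f' t →
      HasDerivAt (fun t => (f t).im) f'.im t := fun h =>
    (Complex.imCLM.hasFDerivAt.comp_hasDerivAt _ h)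
  have hns : ∀ z : ℂ, ‖z‖ ^ 2 = z.re ^ 2 + z.im ^ 2 := fun z => by
    rw [← Complex.normSq_eq_norm_sq, Complex.normSq_apply]; ring
  simp only [hns]
  set c := decayRate r with hc
  set E : ℝ → ℝ := fun t => ((r ^ 2 + 1 / 4) * ((w t).re ^ 2 + (w t).im ^ 2) +
    ((v t).re ^ 2 + (v t).im ^ 2)) * Real.exp (c * t) with hE
  have hc1 : c ≤ 1 / 2 := by
    rw [hc, decayRate, div_le_iff₀ (by positivity)]; nlinarith
  have hc0 : 0 ≤ c := by rw [hc, decayRate]; positivity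
  have hc2 : c * (r ^ 2 + 3 / 4) ≤ r ^ 2 := by
    rw [hc, decayRate, div_mul_eq_mul_div, div_le_iff₀ (by positivity)]
    nlinarith [sq_nonneg r, sq_nonneg (r ^ 2)]
  -- The cross terms in the derivative of the energy combine so that it equals -(|w'|² + r²|w|²)
  -- with w' = v - w/2. This inequality, applied to real and imaginary parts, bounds the dissipation
  -- below by c times the energy.
  have hpt : ∀ a b : ℝ, c * ((r ^ 2 + 1 / 4) * a ^ 2 + b ^ 2) ≤ (b - a / 2) ^ 2 + r ^ 2 * a ^ 2 := by
    intro a b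
    have h1 : b ^ 2 ≤ 2 * (b - a / 2) ^ 2 + a ^ 2 / 2 := by nlinarith [sq_nonneg (b - a)]
    have h2 : c * b ^ 2 ≤ c * (2 * (b - a / 2) ^ 2 + a ^ 2 / 2) := by gcongr
    have h3 : c * (2 * (b - a / 2) ^ 2) ≤ 1 / 2 * (2 * (b - a / 2) ^ 2) := by gcongr
    have h4 : c * (r ^ 2 + 3 / 4) * a ^ 2 ≤ r ^ 2 * a ^ 2 := by gcongr
    nlinarith
  have hEd : ∀ t, HasDerivAt E (((r ^ 2 + 1 / 4) * (2 * (w t).re * (v t - w t / 2).re +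
      2 * (w t).im * (v t - w t / 2).im) +
      (2 * (v t).re * (-v t / 2 + w t / 4 - (r : ℂ) ^ 2 * w t).re +
      2 * (v t).im * (-v t / 2 + w t / 4 - (r : ℂ) ^ 2 * w t).im)) * Real.exp (c * t) +
      ((r ^ 2 + 1 / 4) * ((w t).re ^ 2 + (w t).im ^ 2) +
        ((v t).re ^ 2 + (v t).im ^ 2)) * (Real.exp (c * t) * c)) t := by
    intro t
    have h1 := (((hre (hw t)).pow 2).add ((him (hw t)).pow 2)).const_mul (r ^ 2 + 1 / 4)
    have h2 := ((hre (hv t)).pow 2).add ((him (hv t)).pow 2)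
    have h3 : HasDerivAt (fun t => Real.exp (c * t)) (Real.exp (c * t) * c) t := by
      simpa using ((hasDerivAt_id t).const_mul c).exp
    convert! (h1.add h2).mul h3 using 1
    simp
  have hanti : Antitone E := by
    refine antitone_of_deriv_nonpos (fun t => (hEd t).differentiableAt) fun t => ?_
    rw [(hEd t).deriv]
    have e : ((r : ℂ) ^ 2) = ((r ^ 2 : ℝ) : ℂ) := by push_cast; rfl
    rw [e]
    simp only [Complex.sub_re, Complex.sub_im, Complex.add_re, Complex.add_im, Complex.neg_re,
      Complex.neg_im, Complex.div_ofNat_re, Complex.div_ofNat_im, Complex.re_ofReal_mul,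
      Complex.im_ofReal_mul]
    have h1 := hpt (w t).re (v t).re
    have h2 := hpt (w t).im (v t).im
    have hx : 0 < Real.exp (c * t) := Real.exp_pos _
    set x := Real.exp (c * t)
    have : ∀ y z : ℝ, y + z * c ≤ 0 → y * x + z * (x * c) ≤ 0 := fun y z h => by
      have := mul_nonpos_of_nonpos_of_nonneg h hx.le
      linarith
    apply this
    nlinarith
  have h := hanti ht
  simp only [hE, mul_zero, Real.exp_zero, mul_one] at h
  rw [Real.exp_neg, ← div_eq_mul_inv, le_div_iff₀ (Real.exp_pos _)]
  exact h

/-- The data (0, 1) have initial energy 1. -/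
theorem norm_K1_sq_le {t : ℝ} (ht : 0 ≤ t) (r : ℝ) :
    (r ^ 2 + 1 / 4) * ‖K1 t r‖ ^ 2 ≤ Real.exp (-(decayRate r * t)) := by
  have h := energy_le (r := r) (w := fun t => K1 t r) (v := fun t => K0 t r - K1 t r / 2)
    (fun t => by convert! hasDerivAt_K1 t r using 1; ring)
    (fun t => by
      convert! (hasDerivAt_K0 t r).sub ((hasDerivAt_K1 t r).div_const 2) using 1
      ring) ht
  simp only [K0_zero, K1_zero] at h
  norm_num at h
  have : 0 ≤ ‖K0 t r - K1 t r / 2‖ ^ 2 := by positivity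
  linarith

/-- The data (1, 0) have w = 1 and v = 1/2, hence initial energy r² + 1/2 ≤ 2 (r² + 1/4). -/
theorem norm_K0_sq_le {t : ℝ} (ht : 0 ≤ t) (r : ℝ) :
    ‖K0 t r‖ ^ 2 ≤ 2 * Real.exp (-(decayRate r * t)) := by
  have h := energy_le (r := r) (w := fun t => K0 t r)
    (v := fun t => -(r : ℂ) ^ 2 * K1 t r + K0 t r / 2)
    (fun t => by convert! hasDerivAt_K0 t r using 1; ring)
    (fun t => by
      convert! ((hasDerivAt_K1 t r).const_mul (-(r : ℂ) ^ 2)).add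
        ((hasDerivAt_K0 t r).div_const 2) using 1
      ring) ht
  simp only [K0_zero, K1_zero] at h
  norm_num at h
  have h1 : 0 ≤ ‖-((r : ℂ) ^ 2 * K1 t r) + K0 t r / 2‖ ^ 2 := by positivity
  have hx := Real.exp_pos (-(decayRate r * t))
  have h2 : (r ^ 2 + 1 / 4) * ‖K0 t r‖ ^ 2 ≤
      (r ^ 2 + 1 / 4) * (2 * Real.exp (-(decayRate r * t))) := by nlinarith [sq_nonneg r]
  exact le_of_mul_le_mul_left h2 (by positivity)

/-- One term of the exponential series dominates the power. The rate 1/4 matches the lower bounds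
r²/4 (for r ≤ 1) and 1/4 (for r ≥ 1) of `decayRate`. -/
theorem one_add_rpow_le_exp (a : ℝ) :
    ∃ C : ℝ, 0 < C ∧ ∀ y : ℝ, 0 ≤ y → (1 + y) ^ a ≤ C * Real.exp (y / 4) := by
  obtain ⟨k, hk⟩ := exists_nat_ge a
  refine ⟨4 ^ k * k.factorial * Real.exp (1 / 4), by positivity, fun y hy => ?_⟩
  have h1 : (1 + y) ^ a ≤ (1 + y) ^ k := by
    rw [← Real.rpow_natCast]
    exact Real.rpow_le_rpow_of_exponent_le (by linarith) hk
  have h2 := Real.pow_div_factorial_le_exp (x := (1 + y) / 4) (by positivity) k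
  rw [div_le_iff₀ (by positivity), div_pow, div_le_iff₀ (by positivity)] at h2
  have h3 : Real.exp ((1 + y) / 4) = Real.exp (1 / 4) * Real.exp (y / 4) := by
    rw [← Real.exp_add]; ring_nf
  rw [h3] at h2
  calc _ ≤ _ := h1
    _ ≤ _ := h2
    _ = _ := by ring

/-- The low frequencies decay like those of the heat equation, the high ones exponentially. -/
theorem weighted_decay_le {γ : ℝ} (hγ : 0 ≤ γ) :
    ∃ C : ℝ, 0 < C ∧ ∀ t r : ℝ, 0 ≤ t → 0 < r →
      (1 + t) ^ γ * (1 + (1 + t) * r ^ 2) * Real.exp (-(decayRate r * t)) ≤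
        C * ((r ^ (-γ)) ^ 2 + (1 + r ^ 2)) := by
  obtain ⟨C, hC, h⟩ := one_add_rpow_le_exp (γ + 1)
  refine ⟨C * Real.exp (1 / 4), by positivity, fun t r ht hr => ?_⟩
  have h1t : 0 < 1 + t := by linarith
  have hpow : ∀ y : ℝ, 0 ≤ y → (1 + y) ^ (γ + 1) = (1 + y) ^ γ * (1 + y) := fun y hy => by
    rw [Real.rpow_add_one (by linarith)]
  have he1 : 1 ≤ Real.exp (1 / 4) := Real.one_le_exp (by norm_num)
  rcases le_total r 1 with hr1 | hr1
  · set y := (1 + t) * r ^ 2 with hy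
    have hy0 : 0 ≤ y := by positivity
    have hc : r ^ 2 / 4 ≤ decayRate r := by
      rw [decayRate]
      apply div_le_div_of_nonneg_left <;> nlinarith
    -- Replacing t by 1 + t in the exponent costs exp(r²/4) ≤ exp(1/4).
    have hexp : Real.exp (-(decayRate r * t)) ≤ Real.exp (1 / 4) * Real.exp (-(y / 4)) := by
      rw [← Real.exp_add]
      apply Real.exp_le_exp.2
      have : r ^ 2 / 4 * t ≤ decayRate r * t := by gcongr
      have : r ^ 2 ≤ 1 := by nlinarith
      rw [hy]; nlinarith
    -- The time weight is traded for the singular weight r^{-2γ} of `Ḣ^{-γ}`; the remaining power of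
    -- y is absorbed by exp(-y/4).
    have e1 : (1 + t) ^ γ = y ^ γ * (r ^ (-γ)) ^ 2 := by
      rw [hy, Real.mul_rpow h1t.le (by positivity), ← Real.rpow_natCast, ← Real.rpow_natCast,
        ← Real.rpow_mul hr.le, ← Real.rpow_mul hr.le, mul_assoc, ← Real.rpow_add hr]
      norm_num
      rw [show 2 * γ + -(γ * 2) = 0 by ring]; simp
    have hyg : y ^ γ ≤ (1 + y) ^ γ := Real.rpow_le_rpow hy0 (by linarith) hγ
    have h2 := h y hy0
    rw [hpow y hy0] at h2
    calc (1 + t) ^ γ * (1 + y) * Real.exp (-(decayRate r * t))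
        ≤ ((1 + y) ^ γ * (r ^ (-γ)) ^ 2) * (1 + y) * (Real.exp (1 / 4) * Real.exp (-(y / 4))) := by
          rw [e1]; gcongr
      _ = ((1 + y) ^ γ * (1 + y)) * Real.exp (-(y / 4)) * (Real.exp (1 / 4) * (r ^ (-γ)) ^ 2) := by ring
      _ ≤ (C * Real.exp (y / 4)) * Real.exp (-(y / 4)) * (Real.exp (1 / 4) * (r ^ (-γ)) ^ 2) := by
          gcongr
      _ = C * Real.exp (1 / 4) * (r ^ (-γ)) ^ 2 := by
          rw [mul_assoc C, ← Real.exp_add, add_neg_cancel, Real.exp_zero]; ring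
      _ ≤ _ := by
          gcongr
          have : 0 ≤ 1 + r ^ 2 := by positivity
          linarith
  · have hc : 1 / 4 ≤ decayRate r := by
      rw [decayRate, div_le_div_iff₀ (by norm_num) (by positivity)]; nlinarith
    have hexp : Real.exp (-(decayRate r * t)) ≤ Real.exp (-(t / 4)) := by
      apply Real.exp_le_exp.2
      have : 1 / 4 * t ≤ decayRate r * t := by gcongr
      linarith
    have h2 := h t ht
    rw [hpow t ht] at h2
    calc (1 + t) ^ γ * (1 + (1 + t) * r ^ 2) * Real.exp (-(decayRate r * t))
        ≤ (1 + t) ^ γ * ((1 + t) * (1 + r ^ 2)) * Real.exp (-(t / 4)) := by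
          gcongr; nlinarith
      _ = ((1 + t) ^ γ * (1 + t)) * Real.exp (-(t / 4)) * (1 + r ^ 2) := by ring
      _ ≤ (C * Real.exp (t / 4)) * Real.exp (-(t / 4)) * (1 + r ^ 2) := by gcongr
      _ = C * (1 + r ^ 2) := by
          rw [mul_assoc C, ← Real.exp_add, add_neg_cancel, Real.exp_zero]; ring
      _ ≤ C * Real.exp (1 / 4) * (1 + r ^ 2) := by
          gcongr
          exact le_mul_of_one_le_right hC.le he1
      _ ≤ _ := by
          refine mul_le_mul_of_nonneg_left ?_ (by positivity)
          have : 0 ≤ (r ^ (-γ)) ^ 2 := by positivity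
          linarith

/-! ### Abstract Volterra equations in a Banach space. -/

/-- Iterating the integral inequality integrates τ^k each time and produces the factorial. The
sequence d is constant in the uniqueness proof and consists of successive Picard differences in the
existence proof. -/
theorem iterated_volterra_le {L D T : ℝ} (hL : 0 ≤ L) {d : ℕ → ℝ → ℝ}
    (hc : ∀ k, ContinuousOn (d k) (Icc 0 T)) (h0 : ∀ t ∈ Icc 0 T, d 0 t ≤ D)
    (hs : ∀ k, ∀ t ∈ Icc 0 T, d (k + 1) t ≤ L * ∫ τ in (0 : ℝ)..t, d k τ) (k : ℕ) :
    ∀ t ∈ Icc 0 T, d k t ≤ D * ((L * t) ^ k / k.factorial) := by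
  induction k with
  | zero => intro t ht; simpa using h0 t ht
  | succ k ih =>
    intro t ht
    refine (hs k t ht).trans ?_
    have h1 : ∫ τ in (0 : ℝ)..t, d k τ ≤
        ∫ τ in (0 : ℝ)..t, D * ((L * τ) ^ k / k.factorial) := by
      refine intervalIntegral.integral_mono_on ht.1 ?_ ?_ fun τ hτ =>
        ih τ ⟨hτ.1, hτ.2.trans ht.2⟩
      · apply ContinuousOn.intervalIntegrable
        rw [uIcc_of_le ht.1]
        exact (hc k).mono (Icc_subset_Icc_right ht.2)
      · apply Continuous.intervalIntegrable; fun_prop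
    refine (mul_le_mul_of_nonneg_left h1 hL).trans (le_of_eq ?_)
    have e : ∀ τ : ℝ, D * ((L * τ) ^ k / k.factorial) = (D * L ^ k / k.factorial) * τ ^ k := by
      intro τ; rw [mul_pow]; ring
    simp only [e, intervalIntegral.integral_const_mul, integral_pow, Nat.factorial_succ]
    push_cast
    field_simp
    ring

theorem intervalIntegrable_volterra {X : Type*} [NormedAddCommGroup X]
    {N : ℝ → X → X} (hN : Continuous (Function.uncurry N))
    {T t : ℝ} (ht : t ∈ Icc 0 T) {w : ℝ → X} (hw : ContinuousOn w (Icc 0 T)) :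
    IntervalIntegrable (fun τ => N (t - τ) (w τ)) volume 0 t := by
  apply ContinuousOn.intervalIntegrable
  rw [uIcc_of_le ht.1]
  have : ContinuousOn (fun τ => (t - τ, w τ)) (Icc 0 t) :=
    (continuousOn_const.sub continuousOn_id).prodMk (hw.mono (Icc_subset_Icc_right ht.2))
  exact hN.comp_continuousOn this

theorem norm_volterra_sub_le {X : Type*} [NormedAddCommGroup X] [NormedSpace ℝ X]
    {N : ℝ → X → X} (hN : Continuous (Function.uncurry N)) {L M T t : ℝ}
    (hlip : ∀ s, ∀ x ∈ Metric.closedBall (0 : X) M, ∀ y ∈ Metric.closedBall (0 : X) M,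
      ‖N s x - N s y‖ ≤ L * ‖x - y‖)
    {w v : ℝ → X} (hw : ContinuousOn w (Icc 0 T)) (hv : ContinuousOn v (Icc 0 T))
    (hwM : ∀ t ∈ Icc 0 T, w t ∈ Metric.closedBall (0 : X) M)
    (hvM : ∀ t ∈ Icc 0 T, v t ∈ Metric.closedBall (0 : X) M) (ht : t ∈ Icc 0 T) :
    ‖(∫ τ in (0 : ℝ)..t, N (t - τ) (w τ)) - ∫ τ in (0 : ℝ)..t, N (t - τ) (v τ)‖ ≤
      L * ∫ τ in (0 : ℝ)..t, ‖w τ - v τ‖ := by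
  rw [← intervalIntegral.integral_sub (intervalIntegrable_volterra hN ht hw)
    (intervalIntegrable_volterra hN ht hv), ← intervalIntegral.integral_const_mul]
  refine intervalIntegral.norm_integral_le_of_norm_le ht.1 (.of_forall fun τ hτ => ?_) ?_
  · have hτ' : τ ∈ Icc 0 T := ⟨hτ.1.le, hτ.2.trans ht.2⟩
    exact hlip _ _ (hwM τ hτ') _ (hvM τ hτ')
  · apply ContinuousOn.intervalIntegrable
    rw [uIcc_of_le ht.1]
    exact continuousOn_const.mul ((hw.sub hv).norm.mono (Icc_subset_Icc_right ht.2))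

/-- On the compact interval both solutions lie in one ball, where the kernel is Lipschitz; their
distance is then at most (M₁ + M₂)(Lt)^k / k! for every k. -/
theorem volterra_unique {X : Type*} [NormedAddCommGroup X] [NormedSpace ℝ X]
    {N : ℝ → X → X} (hN : Continuous (Function.uncurry N))
    (hlip : ∀ M : ℝ, ∃ L : ℝ, 0 ≤ L ∧ ∀ s, ∀ x ∈ Metric.closedBall (0 : X) M,
      ∀ y ∈ Metric.closedBall (0 : X) M, ‖N s x - N s y‖ ≤ L * ‖x - y‖)
    {T : ℝ} {a w v : ℝ → X} (hw : ContinuousOn w (Icc 0 T)) (hv : ContinuousOn v (Icc 0 T))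
    (hwe : ∀ t ∈ Icc 0 T, w t = a t + ∫ τ in (0 : ℝ)..t, N (t - τ) (w τ))
    (hve : ∀ t ∈ Icc 0 T, v t = a t + ∫ τ in (0 : ℝ)..t, N (t - τ) (v τ)) :
    ∀ t ∈ Icc 0 T, w t = v t := by
  obtain ⟨M1, h1⟩ := isCompact_Icc.exists_bound_of_continuousOn hw
  obtain ⟨M2, h2⟩ := isCompact_Icc.exists_bound_of_continuousOn hv
  set M := max M1 M2
  obtain ⟨L, hL, hLM⟩ := hlip M
  have hwM : ∀ t ∈ Icc 0 T, w t ∈ Metric.closedBall (0 : X) M := fun t ht => by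
    simpa [M] using Or.inl (h1 t ht)
  have hvM : ∀ t ∈ Icc 0 T, v t ∈ Metric.closedBall (0 : X) M := fun t ht => by
    simpa [M] using Or.inr (h2 t ht)
  intro t ht
  have key := iterated_volterra_le (T := T) (D := M1 + M2) hL (d := fun _ t => ‖w t - v t‖)
    (fun k => (hw.sub hv).norm)
    (fun t ht => (norm_sub_le _ _).trans (add_le_add (h1 t ht) (h2 t ht)))
    (fun k t ht => by
      have := norm_volterra_sub_le hN hLM hw hv hwM hvM ht
      rwa [← add_sub_add_left_eq_sub _ _ (a t), ← hwe t ht, ← hve t ht] at this)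
  have hlim := ((FloorSemiring.tendsto_pow_div_factorial_atTop (L * t)).const_mul (M1 + M2))
  rw [mul_zero] at hlim
  have := ge_of_tendsto hlim (.of_forall fun k => key k t ht)
  exact sub_eq_zero.1 (norm_le_zero_iff.1 this)

/-- Picard iteration from 0. The sets B t carry a time-dependent a priori bound that the iteration
preserves, and they keep all iterates in a ball with a single Lipschitz constant L. The factorial
estimate then gives uniform convergence on [0, T] with no smallness of LT. The kernel and the free
term are continuous on all of ℝ, so every iterate is as well. -/
theorem volterra_exists {X : Type*} [NormedAddCommGroup X] [NormedSpace ℝ X] [CompleteSpace X]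
    {N : ℝ → X → X} (hN : Continuous (Function.uncurry N))
    {L M T : ℝ} (hL : 0 ≤ L)
    (hlip : ∀ s, ∀ x ∈ Metric.closedBall (0 : X) M, ∀ y ∈ Metric.closedBall (0 : X) M,
      ‖N s x - N s y‖ ≤ L * ‖x - y‖)
    {a : ℝ → X} (ha : Continuous a) {B : ℝ → Set X}
    (hB0 : ∀ t, 0 ∈ B t) (hBM : ∀ t ∈ Icc 0 T, B t ⊆ Metric.closedBall 0 M)
    (hinv : ∀ w : ℝ → X, Continuous w → (∀ t ∈ Icc 0 T, w t ∈ B t) →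
      ∀ t ∈ Icc 0 T, a t + ∫ τ in (0 : ℝ)..t, N (t - τ) (w τ) ∈ B t) :
    ∃ w : ℝ → X, ContinuousOn w (Icc 0 T) ∧
      ∀ t ∈ Icc 0 T, w t = a t + ∫ τ in (0 : ℝ)..t, N (t - τ) (w τ) := by
  set Ψ : (ℝ → X) → ℝ → X := fun w t => a t + ∫ τ in (0 : ℝ)..t, N (t - τ) (w τ) with hΨ
  set u : ℕ → ℝ → X := fun k => Ψ^[k] 0 with hu
  have hus : ∀ k, u (k + 1) = Ψ (u k) := fun k => Function.iterate_succ_apply' Ψ k 0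
  have huc : ∀ k, Continuous (u k) := by
    intro k
    induction k with
    | zero => exact continuous_const
    | succ k ih =>
      rw [hus]
      refine ha.add ?_
      refine intervalIntegral.continuous_parametric_intervalIntegral_of_continuous
        (f := fun t τ => N (t - τ) (u k τ)) ?_ continuous_id
      exact hN.comp ((continuous_fst.sub continuous_snd).prodMk (ih.comp continuous_snd))
  have huB : ∀ k, ∀ t ∈ Icc 0 T, u k t ∈ B t := by
    intro k
    induction k with
    | zero => exact fun t _ => hB0 t
    | succ k ih => rw [hus]; exact hinv _ (huc k) ih
  have huM : ∀ k, ∀ t ∈ Icc 0 T, u k t ∈ Metric.closedBall (0 : X) M := fun k t ht =>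
    hBM t ht (huB k t ht)
  have hdiff := iterated_volterra_le (T := T) (D := 2 * M) hL
    (d := fun k t => ‖u (k + 1) t - u k t‖)
    (fun k => ((huc _).sub (huc _)).norm.continuousOn)
    (fun t ht => by
      have h1 := huM 1 t ht
      have h0 := huM 0 t ht
      rw [mem_closedBall_zero_iff] at h0 h1
      exact (norm_sub_le _ _).trans (by simpa [two_mul] using add_le_add h1 h0))
    (fun k t ht => by
      have := norm_volterra_sub_le hN hlip (huc (k + 1)).continuousOn (huc k).continuousOn
        (huM _) (huM _) ht
      rw [← add_sub_add_left_eq_sub _ _ (a t)] at this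
      rw [congrFun (hus (k + 1)) t, congrFun (hus k) t]
      exact this)
  by_cases hT : 0 ≤ T
  swap
  · exact ⟨0, continuousOn_const, fun t ht => absurd (ht.1.trans ht.2) hT⟩
  have hM : 0 ≤ M := by
    have := huM 0 0 ⟨le_rfl, hT⟩
    rw [mem_closedBall_zero_iff] at this
    exact (norm_nonneg _).trans this
  have hunif := tendstoUniformlyOn_tsum_nat (s := Icc 0 T)
    (f := fun k t => u (k + 1) t - u k t)
    (u := fun k => 2 * M * ((L * T) ^ k / k.factorial))
    ((Real.summable_pow_div_factorial (L * T)).mul_left _) (fun k t ht => by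
      refine (hdiff k t ht).trans ?_
      have := ht.1
      have := ht.2
      gcongr)
  set w : ℝ → X := fun t => ∑' k, (u (k + 1) t - u k t) with hw
  -- The sum telescopes and the zeroth iterate is 0, so the partial sums are the iterates
  -- themselves.
  have hunif' : TendstoUniformlyOn u w atTop (Icc 0 T) := by
    refine hunif.congr (.of_forall fun k t ht => ?_)
    simp only [Finset.sum_range_sub (fun k => u k t)]
    simp [hu]
  have hwc : ContinuousOn w (Icc 0 T) := hunif'.continuousOn (.of_forall fun k => (huc k).continuousOn)
  have hwM : ∀ t ∈ Icc 0 T, w t ∈ Metric.closedBall (0 : X) M := fun t ht =>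
    Metric.isClosed_closedBall.mem_of_tendsto (hunif'.tendsto_at ht) (.of_forall fun k => huM k t ht)
  refine ⟨w, hwc, fun t ht => ?_⟩
  refine tendsto_nhds_unique ((tendsto_add_atTop_iff_nat 1).2 (hunif'.tendsto_at ht)) ?_
  simp only [hus, hΨ]
  refine tendsto_const_nhds.add ?_
  rw [Metric.tendsto_atTop]
  intro ε hε
  rw [Metric.tendstoUniformlyOn_iff] at hunif'
  have hδ : 0 < ε / (L * T + 1) := by positivity
  obtain ⟨k0, hk0⟩ := eventually_atTop.1 (hunif' _ hδ)
  refine ⟨k0, fun k hk => ?_⟩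
  rw [dist_eq_norm]
  refine (norm_volterra_sub_le hN hlip (huc k).continuousOn hwc (huM k) hwM ht).trans_lt ?_
  have h1 : ∫ τ in (0 : ℝ)..t, ‖u k τ - w τ‖ ≤ ∫ τ in (0 : ℝ)..t, ε / (L * T + 1) := by
    refine intervalIntegral.integral_mono_on ht.1 ?_ (by simp) fun τ hτ => ?_
    · apply ContinuousOn.intervalIntegrable
      rw [uIcc_of_le ht.1]
      exact ((huc k).continuousOn.sub hwc).norm.mono (Icc_subset_Icc_right ht.2)
    · have := hk0 k hk τ ⟨hτ.1, hτ.2.trans ht.2⟩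
      rw [dist_comm, dist_eq_norm] at this
      exact this.le
  rw [intervalIntegral.integral_const, sub_zero, smul_eq_mul] at h1
  have h2 : L * (t * (ε / (L * T + 1))) ≤ L * (T * (ε / (L * T + 1))) := by
    have := ht.2
    gcongr
  have h3 : L * (T * (ε / (L * T + 1))) < ε := by
    rw [← mul_assoc, ← mul_div_assoc, div_lt_iff₀ (by positivity)]
    nlinarith
  exact (mul_le_mul_of_nonneg_left h1 hL).trans_lt (h2.trans_lt h3)

/-! ### Radial Fourier multipliers on `L²` -/

/-- Multiplication by a bounded radial symbol. -/
def mulOp {n : ℕ} {m : ℝ → ℂ} (hm : Measurable m) {C : ℝ} (hC : ∀ r, ‖m r‖ ≤ C) :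
    L2 n →L[ℂ] L2 n :=
  LinearMap.mkContinuous
    { toFun := fun f => (memLp_radial_mul hm hC f).toLp _
      map_add' := fun f g => by
        apply Lp.ext
        filter_upwards [(memLp_radial_mul hm hC (f + g)).coeFn_toLp,
          (memLp_radial_mul hm hC f).coeFn_toLp, (memLp_radial_mul hm hC g).coeFn_toLp,
          Lp.coeFn_add f g, Lp.coeFn_add ((memLp_radial_mul hm hC f).toLp _)
            ((memLp_radial_mul hm hC g).toLp _)] with ξ h1 h2 h3 h4 h5
        rw [h1, h5, Pi.add_apply, h2, h3, h4, Pi.add_apply, mul_add]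
      map_smul' := fun c f => by
        apply Lp.ext
        filter_upwards [(memLp_radial_mul hm hC (c • f)).coeFn_toLp,
          (memLp_radial_mul hm hC f).coeFn_toLp, Lp.coeFn_smul c f,
          Lp.coeFn_smul c ((memLp_radial_mul hm hC f).toLp _)] with ξ h1 h2 h3 h4
        rw [h1, RingHom.id_apply, h4, Pi.smul_apply, h2, h3, Pi.smul_apply, smul_eq_mul,
          smul_eq_mul]
        ring } C
    fun f => by
      have hC0 : 0 ≤ C := (norm_nonneg _).trans (hC 0)
      refine Lp.norm_le_mul_norm_of_ae_le_mul ?_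
      filter_upwards [(memLp_radial_mul hm hC f).coeFn_toLp] with ξ h1
      change ‖((memLp_radial_mul hm hC f).toLp _ : L2 n) ξ‖ ≤ _
      rw [h1, norm_mul]
      gcongr
      exact hC _

theorem coeFn_mulOp {n : ℕ} {m : ℝ → ℂ} (hm : Measurable m) {C : ℝ} (hC : ∀ r, ‖m r‖ ≤ C)
    (f : L2 n) : mulOp hm hC f =ᵐ[volume] fun ξ => m (2 * Real.pi * ‖ξ‖) * f ξ :=
  (memLp_radial_mul hm hC f).coeFn_toLp

theorem norm_mulOp_le {n : ℕ} {m : ℝ → ℂ} (hm : Measurable m) {C : ℝ} (hC : ∀ r, ‖m r‖ ≤ C)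
    (f : L2 n) : ‖mulOp hm hC f‖ ≤ C * ‖f‖ :=
  (mulOp hm hC).le_of_opNorm_le
    (LinearMap.mkContinuous_norm_le _ ((norm_nonneg _).trans (hC 0)) _) f

/-- Dominated convergence with majorant (2C)²|f|². Only strong continuity in t is claimed: the
symbols are continuous in t for each fixed r. -/
theorem continuous_mulOp {n : ℕ} {m : ℝ → ℝ → ℂ} (hm : ∀ t, Measurable (m t)) {C : ℝ}
    (hC : ∀ t r, ‖m t r‖ ≤ C) (hc : ∀ r, Continuous fun t => m t r) (f : L2 n) :
    Continuous fun t => mulOp (hm t) (hC t) f := by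
  have hC0 : 0 ≤ C := (norm_nonneg _).trans (hC 0 0)
  rw [continuous_iff_continuousAt]
  intro t₀
  rw [ContinuousAt, tendsto_iff_edist_tendsto_0]
  have e : ∀ t, edist (mulOp (hm t) (hC t) f) (mulOp (hm t₀) (hC t₀) f) =
      (∫⁻ ξ, ‖(m t (2 * Real.pi * ‖ξ‖) - m t₀ (2 * Real.pi * ‖ξ‖)) * f ξ‖ₑ ^ (2 : ℝ)) ^
        (1 / (2 : ℝ)) := by
    intro t
    rw [Lp.edist_def, eLpNorm_eq_lintegral_rpow_enorm_toReal (by norm_num) (by norm_num)]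
    simp only [ENNReal.toReal_ofNat]
    congr 1
    apply lintegral_congr_ae
    filter_upwards [coeFn_mulOp (hm t) (hC t) f, coeFn_mulOp (hm t₀) (hC t₀) f] with ξ h1 h2
    rw [Pi.sub_apply, h1, h2, sub_mul]
  simp only [e]
  have hfm : Measurable (fun ξ => f ξ) := (Lp.stronglyMeasurable f).measurable
  have hr : Measurable (fun ξ : Rn n => 2 * Real.pi * ‖ξ‖) := by fun_prop
  have key : Tendsto (fun t => ∫⁻ ξ, ‖(m t (2 * Real.pi * ‖ξ‖) - m t₀ (2 * Real.pi * ‖ξ‖)) *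
      f ξ‖ₑ ^ (2 : ℝ)) (𝓝 t₀) (𝓝 (∫⁻ _ : Rn n, 0)) := by
    refine tendsto_lintegral_filter_of_dominated_convergence
      (fun ξ => ENNReal.ofReal (2 * C) ^ (2 : ℝ) * ‖f ξ‖ₑ ^ (2 : ℝ)) ?_ ?_ ?_ ?_
    · refine .of_forall fun t => ?_
      exact ((((hm t).comp hr).sub ((hm t₀).comp hr)).mul hfm).enorm.pow_const _
    · refine .of_forall fun t => .of_forall fun ξ => ?_
      rw [enorm_mul, ENNReal.mul_rpow_of_nonneg _ _ (by norm_num)]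
      gcongr
      rw [← ofReal_norm]
      apply ENNReal.ofReal_le_ofReal
      refine (norm_sub_le _ _).trans ?_
      linarith [hC t (2 * Real.pi * ‖ξ‖), hC t₀ (2 * Real.pi * ‖ξ‖)]
    · rw [lintegral_const_mul'' _ (hfm.enorm.pow_const _).aemeasurable]
      refine ENNReal.mul_ne_top (ENNReal.rpow_ne_top_of_nonneg (by norm_num) ENNReal.ofReal_ne_top) ?_
      have := (Lp.memLp f).2
      rw [eLpNorm_lt_top_iff_lintegral_rpow_enorm_lt_top (by norm_num) (by norm_num)] at this
      simpa using this.ne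
    · refine .of_forall fun ξ => ?_
      have h1 : Tendsto (fun t => ‖(m t (2 * Real.pi * ‖ξ‖) - m t₀ (2 * Real.pi * ‖ξ‖)) *
          f ξ‖ₑ ^ (2 : ℝ)) (𝓝 t₀) (𝓝 (‖(m t₀ (2 * Real.pi * ‖ξ‖) - m t₀ (2 * Real.pi * ‖ξ‖)) *
          f ξ‖ₑ ^ (2 : ℝ))) :=
        ((ENNReal.continuous_rpow_const.comp (continuous_enorm.comp
          (((hc _).sub continuous_const).mul continuous_const))).tendsto t₀)
      simpa using h1
  have := (ENNReal.continuous_rpow_const (y := 1 / (2 : ℝ))).tendsto (∫⁻ _ : Rn n, 0) |>.comp key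
  simpa using! this

theorem ae_two_pi_norm_pos {n : ℕ} (hn : 1 ≤ n) : ∀ᵐ ξ : Rn n, 0 < 2 * Real.pi * ‖ξ‖ := by
  have : Nontrivial (Rn n) := by
    have : Nonempty (Fin n) := ⟨⟨0, hn⟩⟩
    infer_instance
  filter_upwards [measure_eq_zero_iff_ae_notMem.1 (measure_singleton (0 : Rn n))] with ξ hξ
  have : 0 < ‖ξ‖ := norm_pos_iff.2 hξ
  positivity

/-! ### `H¹` as an isometric copy of `L²` -/

/-- The symbol of `(1 - Δ)^{-1/2}`. -/
def besselSymbol (r : ℝ) : ℂ := (((√(1 + r ^ 2))⁻¹ : ℝ) : ℂ)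

theorem measurable_besselSymbol : Measurable besselSymbol := by
  unfold besselSymbol; fun_prop

theorem one_le_sqrt_one_add_sq (r : ℝ) : 1 ≤ √(1 + r ^ 2) :=
  Real.one_le_sqrt.2 (by nlinarith [sq_nonneg r])

theorem norm_besselSymbol (r : ℝ) : ‖besselSymbol r‖ = (√(1 + r ^ 2))⁻¹ := by
  rw [besselSymbol, Complex.norm_real, Real.norm_eq_abs, abs_of_nonneg (by positivity)]

theorem norm_besselSymbol_le (r : ℝ) : ‖besselSymbol r‖ ≤ 1 := by
  rw [norm_besselSymbol]
  exact inv_le_one_of_one_le₀ (one_le_sqrt_one_add_sq r)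

theorem sqrt_mul_besselSymbol (r : ℝ) : ((√(1 + r ^ 2) : ℝ) : ℂ) * besselSymbol r = 1 := by
  have : √(1 + r ^ 2) ≠ 0 := by have := one_le_sqrt_one_add_sq r; positivity
  rw [besselSymbol, ← Complex.ofReal_mul, mul_inv_cancel₀ this, Complex.ofReal_one]

/-- The isometry from `L²` (in the frequency variable) onto `H¹`. -/
def toH1 {n : ℕ} : L2 n →L[ℂ] L2 n :=
  ((Lp.fourierTransformₗᵢ (Rn n) ℂ).symm.toContinuousLinearEquiv : L2 n →L[ℂ] L2 n).comp
    (mulOp measurable_besselSymbol norm_besselSymbol_le)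

theorem toH1_apply {n : ℕ} (w : L2 n) :
    toH1 w = 𝓕⁻ (mulOp measurable_besselSymbol norm_besselSymbol_le w) := rfl

theorem fourier_toH1 {n : ℕ} (w : L2 n) :
    𝓕 (toH1 w) = mulOp measurable_besselSymbol norm_besselSymbol_le w :=
  FourierTransform.fourier_fourierInv_eq (E := L2 n) (F := L2 n) _

theorem sobolevNorm_toH1 {n : ℕ} (w : L2 n) : sobolevNorm 1 (toH1 w) = ‖w‖ₑ := by
  rw [sobolevNorm, fourier_toH1, Lp.enorm_def]
  apply eLpNorm_congr_ae
  filter_upwards [coeFn_mulOp measurable_besselSymbol norm_besselSymbol_le w] with ξ h1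
  rw [h1, ← mul_assoc, ← Real.sqrt_eq_rpow, sqrt_mul_besselSymbol, one_mul]

theorem exists_toH1_eq {n : ℕ} {f : L2 n} (hf : sobolevNorm 1 f < ∞) : ∃ w, toH1 w = f := by
  have hm : MemLp (fun ξ : Rn n =>
      (((1 + (2 * Real.pi * ‖ξ‖) ^ 2) ^ ((1 : ℝ) / 2) : ℝ) : ℂ) * (𝓕 f : L2 n) ξ) 2 volume := by
    refine ⟨AEStronglyMeasurable.mul ?_ (Lp.aestronglyMeasurable _), hf⟩
    refine (Complex.measurable_ofReal.comp ?_).aestronglyMeasurable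
    exact Measurable.pow_const (by fun_prop) _
  refine ⟨hm.toLp _, ?_⟩
  refine Eq.trans ?_ (FourierTransform.fourierInv_fourier_eq (E := L2 n) (F := L2 n) f)
  rw [toH1_apply]
  congr 1
  apply Lp.ext
  filter_upwards [coeFn_mulOp measurable_besselSymbol norm_besselSymbol_le (hm.toLp _),
    hm.coeFn_toLp] with ξ h1 h2
  rw [h1, h2, ← mul_assoc, ← Real.sqrt_eq_rpow, mul_comm (besselSymbol _), sqrt_mul_besselSymbol,
    one_mul]

theorem toH1_injective {n : ℕ} : Function.Injective (toH1 : L2 n → L2 n) := by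
  intro w v h
  have h1 := sobolevNorm_toH1 (w - v)
  rw [map_sub, h, sub_self, ← map_zero (toH1 : L2 n →L[ℂ] L2 n), sobolevNorm_toH1, enorm_zero] at h1
  exact sub_eq_zero.1 (enorm_eq_zero.1 h1.symm)

/-- Since `toH1` is isometric onto `H¹`, continuity in `H¹` is ordinary continuity of the `L²`
representative, and the abstract Volterra results apply. -/
theorem isContinuousInH1_toH1_iff {n : ℕ} {T : ℝ} {w : ℝ → L2 n} :
    IsContinuousInH1 T (fun t => toH1 (w t)) ↔ ContinuousOn w (Ico 0 T) := by
  have e : ∀ s t, sobolevNorm 1 (toH1 (w s) - toH1 (w t)) = edist (w s) (w t) := fun s t => by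
    rw [← map_sub, sobolevNorm_toH1, edist_eq_enorm_sub]
  simp only [IsContinuousInH1, e, sobolevNorm_toH1, enorm_lt_top, true_and, ContinuousOn,
    ContinuousWithinAt]
  exact forall₂_congr fun t _ => tendsto_iff_edist_tendsto_0.symm

/-! ### The propagators, with values in `H¹` -/

/-- The symbol of `E₁`, normalised as a map from `L²` to `H¹`. -/
def waveSymbol (t r : ℝ) : ℂ := ((√(1 + r ^ 2) : ℝ) : ℂ) * K1 |t| r

theorem measurable_waveSymbol (t : ℝ) : Measurable (waveSymbol t) := by
  have := measurable_K1 |t|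
  unfold waveSymbol; fun_prop

theorem norm_waveSymbol_sq (t r : ℝ) : ‖waveSymbol t r‖ ^ 2 = (1 + r ^ 2) * ‖K1 |t| r‖ ^ 2 := by
  rw [waveSymbol, norm_mul, Complex.norm_real, Real.norm_eq_abs, mul_pow, sq_abs,
    Real.sq_sqrt (by positivity)]

theorem decayRate_nonneg (r : ℝ) : 0 ≤ decayRate r := by unfold decayRate; positivity

theorem exp_decayRate_le_one {t : ℝ} (ht : 0 ≤ t) (r : ℝ) :
    Real.exp (-(decayRate r * t)) ≤ 1 :=
  Real.exp_le_one_iff.2 (neg_nonpos.2 (mul_nonneg (decayRate_nonneg r) ht))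

/-- The energy bound (r² + 1/4)|K₁|² ≤ 1 together with 1 + r² ≤ 4 (r² + 1/4): `E₁` gains one
derivative, uniformly in time. -/
theorem norm_waveSymbol_le (t r : ℝ) : ‖waveSymbol t r‖ ≤ 2 := by
  have h1 := norm_K1_sq_le (abs_nonneg t) r
  have h2 := exp_decayRate_le_one (abs_nonneg t) r
  have h3 := norm_waveSymbol_sq t r
  refine le_of_sq_le_sq ?_ (by norm_num)
  rw [h3]
  nlinarith [mul_nonneg (sq_nonneg r) (sq_nonneg ‖K1 |t| r‖), sq_nonneg ‖K1 |t| r‖]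

theorem continuous_waveSymbol (r : ℝ) : Continuous fun t => waveSymbol t r := by
  have h : Continuous fun t => K1 t r :=
    continuous_iff_continuousAt.2 fun t => (hasDerivAt_K1 t r).continuousAt
  exact continuous_const.mul (h.comp continuous_abs)

theorem norm_K0_abs_le (t r : ℝ) : ‖K0 |t| r‖ ≤ 2 := by
  have h1 := norm_K0_sq_le (abs_nonneg t) r
  have h2 := exp_decayRate_le_one (abs_nonneg t) r
  refine le_of_sq_le_sq ?_ (by norm_num)
  linarith

theorem continuous_K0_abs (r : ℝ) : Continuous fun t => K0 |t| r := by
  have h : Continuous fun t => K0 t r :=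
    continuous_iff_continuousAt.2 fun t => (hasDerivAt_K0 t r).continuousAt
  exact h.comp continuous_abs

/-- `E₁(|t|)` as a map from `L²` to `H¹`. -/
def waveOp {n : ℕ} (t : ℝ) (f : L2 n) : L2 n :=
  mulOp (measurable_waveSymbol t) (norm_waveSymbol_le t) (𝓕 f)

/-- `E₀(|t|)` as a map from `H¹` to `H¹`. -/
def waveOp0 {n : ℕ} (t : ℝ) (w : L2 n) : L2 n :=
  mulOp (measurable_K0 |t|) (norm_K0_abs_le t) w

theorem toH1_waveOp {n : ℕ} {t : ℝ} (ht : 0 ≤ t) (f : L2 n) : toH1 (waveOp t f) = E1 t f := by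
  rw [toH1_apply, E1]
  congr 1
  apply Lp.ext
  filter_upwards [coeFn_mulOp measurable_besselSymbol norm_besselSymbol_le (waveOp t f),
    coeFn_mulOp (measurable_waveSymbol t) (norm_waveSymbol_le t) (𝓕 f),
    (memLp_radial_mul (measurable_K1 t) (norm_K1_le t) (𝓕 f : L2 n)).coeFn_toLp] with ξ h1 h2 h3
  rw [h1, h3, waveOp, h2, waveSymbol, abs_of_nonneg ht, ← mul_assoc, ← mul_assoc,
    mul_comm (besselSymbol _), sqrt_mul_besselSymbol, one_mul]

theorem toH1_waveOp0 {n : ℕ} {t : ℝ} (ht : 0 ≤ t) (w : L2 n) :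
    toH1 (waveOp0 t w) = E0 t (toH1 w) := by
  rw [toH1_apply, E0]
  congr 1
  apply Lp.ext
  filter_upwards [coeFn_mulOp measurable_besselSymbol norm_besselSymbol_le (waveOp0 t w),
    coeFn_mulOp (measurable_K0 |t|) (norm_K0_abs_le t) w,
    coeFn_mulOp measurable_besselSymbol norm_besselSymbol_le w,
    (memLp_radial_mul (measurable_K0 t) (norm_K0_le t) (𝓕 (toH1 w) : L2 n)).coeFn_toLp]
    with ξ h1 h2 h3 h4
  rw [h1, h4, waveOp0, h2, fourier_toH1, h3, abs_of_nonneg ht]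
  ring

theorem continuous_waveOp0 {n : ℕ} (w : L2 n) : Continuous fun t => waveOp0 t w :=
  continuous_mulOp (fun t => measurable_K0 |t|) norm_K0_abs_le continuous_K0_abs w

theorem continuous_waveOp {n : ℕ} (f : L2 n) : Continuous fun t => waveOp t f :=
  continuous_mulOp measurable_waveSymbol norm_waveSymbol_le continuous_waveSymbol _

theorem norm_waveOp_sub_le {n : ℕ} (t : ℝ) (f g : L2 n) :
    ‖waveOp t f - waveOp t g‖ ≤ 2 * ‖f - g‖ := by
  rw [waveOp, waveOp, ← map_sub]
  refine (norm_mulOp_le _ _ _).trans ?_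
  rw [← Lp.norm_fourier_eq (f - g)]
  have : (𝓕 (f - g) : L2 n) = 𝓕 f - 𝓕 g := (Lp.fourierTransformₗᵢ (Rn n) ℂ).map_sub f g
  rw [this]

theorem continuous_uncurry_of_lipschitz {α X Y : Type*} [TopologicalSpace α]
    [SeminormedAddCommGroup X] [SeminormedAddCommGroup Y] {S : α → X → Y} {K : ℝ}
    (hc : ∀ x, Continuous fun t => S t x) (hK : ∀ t x y, ‖S t x - S t y‖ ≤ K * ‖x - y‖) :
    Continuous (Function.uncurry S) := by
  have h : Continuous fun z : X × α => S z.2 z.1 := by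
    refine continuous_prod_of_continuous_lipschitzWith _ K.toNNReal hc fun t =>
      LipschitzWith.of_dist_le_mul fun x y => ?_
    rw [dist_eq_norm, dist_eq_norm]
    refine (hK t x y).trans (mul_le_mul_of_nonneg_right ?_ (norm_nonneg _))
    exact Real.le_coe_toNNReal K
  exact h.comp continuous_swap

theorem continuous_uncurry_waveOp {n : ℕ} :
    Continuous (Function.uncurry (waveOp : ℝ → L2 n → L2 n)) :=
  continuous_uncurry_of_lipschitz continuous_waveOp norm_waveOp_sub_le

/-! ### Weighted energy norms -/

/-- The symbol `((1 + R r²) / (1 + r²))^{1/2}`. -/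
def weightSymbol (R r : ℝ) : ℂ := ((√((1 + |R| * r ^ 2) / (1 + r ^ 2)) : ℝ) : ℂ)

theorem measurable_weightSymbol (R : ℝ) : Measurable (weightSymbol R) := by
  unfold weightSymbol; fun_prop

theorem norm_weightSymbol (R r : ℝ) :
    ‖weightSymbol R r‖ = √((1 + |R| * r ^ 2) / (1 + r ^ 2)) := by
  rw [weightSymbol, Complex.norm_real, Real.norm_eq_abs, abs_of_nonneg (by positivity)]

theorem norm_weightSymbol_sq {R : ℝ} (hR : 0 ≤ R) (r : ℝ) :
    ‖weightSymbol R r‖ ^ 2 = (1 + R * r ^ 2) / (1 + r ^ 2) := by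
  rw [norm_weightSymbol, Real.sq_sqrt (by positivity), abs_of_nonneg hR]

theorem norm_weightSymbol_le (R r : ℝ) : ‖weightSymbol R r‖ ≤ √(1 + |R|) := by
  rw [norm_weightSymbol]
  apply Real.sqrt_le_sqrt
  rw [div_le_iff₀ (by positivity)]
  nlinarith [abs_nonneg R, sq_nonneg r]

/-- For R ≥ 1 the weighted norm dominates the `H¹` norm, so a weighted bound confines the iterates
to an ordinary ball. -/
theorem one_le_norm_weightSymbol {R : ℝ} (hR : 1 ≤ R) (r : ℝ) : 1 ≤ ‖weightSymbol R r‖ := by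
  rw [norm_weightSymbol, Real.one_le_sqrt, one_le_div (by positivity), abs_of_nonneg (by linarith)]
  nlinarith [sq_nonneg r]

/-- `‖weightOp R w‖² = ‖u‖² + R ‖∇u‖²` for `u = toH1 w`, `R ≥ 0`. -/
def weightOp {n : ℕ} (R : ℝ) : L2 n →L[ℂ] L2 n :=
  mulOp (measurable_weightSymbol R) (norm_weightSymbol_le R)

theorem norm_le_norm_weightOp {n : ℕ} {R : ℝ} (hR : 1 ≤ R) (w : L2 n) : ‖w‖ ≤ ‖weightOp R w‖ := by
  refine Lp.norm_le_norm_of_ae_le ?_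
  filter_upwards [coeFn_mulOp (measurable_weightSymbol R) (norm_weightSymbol_le R) w] with ξ h
  rw [weightOp, h, norm_mul]
  exact le_mul_of_one_le_left (norm_nonneg _) (one_le_norm_weightSymbol hR _)

theorem norm_weightOp_le {n : ℕ} (R : ℝ) (w : L2 n) : ‖weightOp R w‖ ≤ √(1 + |R|) * ‖w‖ :=
  norm_mulOp_le _ _ _

theorem enorm_le_of_ae_le_add {n : ℕ} {f : L2 n} {g h : Rn n → ℂ} {c : ℝ}
    (hg : AEStronglyMeasurable g volume) (hh : AEStronglyMeasurable h volume)
    (H : ∀ᵐ ξ, ‖f ξ‖ ≤ c * (‖g ξ‖ + ‖h ξ‖)) :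
    ‖f‖ₑ ≤ ENNReal.ofReal c * (eLpNorm g 2 volume + eLpNorm h 2 volume) := by
  rw [Lp.enorm_def]
  refine (eLpNorm_le_mul_eLpNorm_of_ae_le_mul (g := fun ξ => ‖g ξ‖ + ‖h ξ‖) (c := c) ?_ 2).trans ?_
  · filter_upwards [H] with ξ hξ
    rwa [Real.norm_of_nonneg (by positivity)]
  · gcongr
    refine (eLpNorm_add_le hg.norm hh.norm (by norm_num)).trans ?_
    rw [eLpNorm_norm, eLpNorm_norm]

theorem aestronglyMeasurable_negSobolev {n : ℕ} (γ : ℝ) (f : L2 n) :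
    AEStronglyMeasurable (fun ξ : Rn n =>
      (((2 * Real.pi * ‖ξ‖) ^ (-γ) : ℝ) : ℂ) * (𝓕 f : L2 n) ξ) volume := by
  refine AEStronglyMeasurable.mul ?_ (Lp.aestronglyMeasurable _)
  refine (Complex.measurable_ofReal.comp ?_).aestronglyMeasurable
  exact Measurable.pow_const (by fun_prop) _

theorem enorm_fourier {n : ℕ} (f : L2 n) : eLpNorm (𝓕 f : L2 n) 2 volume = ‖f‖ₑ := by
  rw [← Lp.enorm_def, ← ofReal_norm, Lp.norm_fourier_eq, ofReal_norm]

/-- Decay of the first fundamental solution in the weighted energy norm. -/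
theorem enorm_weightOp_waveOp0_le {n : ℕ} (hn : 1 ≤ n) {γ : ℝ} (hγ : 0 ≤ γ) :
    ∃ C : ℝ, 0 < C ∧ ∀ t : ℝ, 0 ≤ t → ∀ w : L2 n,
      ‖weightOp (1 + t) (waveOp0 t w)‖ₑ ≤
        ENNReal.ofReal (C * (1 + t) ^ (-(γ / 2))) * (negSobolevNorm γ (toH1 w) + ‖w‖ₑ) := by
  obtain ⟨C, hC, h⟩ := weighted_decay_le hγ
  refine ⟨√(2 * C), by positivity, fun t ht w => ?_⟩
  rw [Lp.enorm_def w]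
  refine enorm_le_of_ae_le_add (aestronglyMeasurable_negSobolev γ _) (Lp.aestronglyMeasurable _) ?_
  filter_upwards [ae_two_pi_norm_pos hn, coeFn_mulOp (measurable_weightSymbol (1 + t))
    (norm_weightSymbol_le (1 + t)) (waveOp0 t w),
    coeFn_mulOp (measurable_K0 |t|) (norm_K0_abs_le t) w,
    coeFn_mulOp measurable_besselSymbol norm_besselSymbol_le w] with ξ hr h1 h2 h3
  rw [weightOp, h1, waveOp0, h2, fourier_toH1, h3]
  generalize 2 * Real.pi * ‖ξ‖ = r at hr ⊢
  rw [norm_mul, norm_mul, norm_mul, norm_mul, ← mul_assoc, ← mul_assoc (‖((r ^ (-γ) : ℝ) : ℂ)‖),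
    ← add_one_mul, ← mul_assoc]
  refine mul_le_mul_of_nonneg_right ?_ (norm_nonneg _)
  refine le_of_sq_le_sq ?_ (by positivity)
  have ht1 : 0 < 1 + t := by linarith
  have hdec := h t r ht hr
  have hK := norm_K0_sq_le ht r
  rw [mul_pow, norm_weightSymbol_sq ht1.le, abs_of_nonneg ht, mul_pow, mul_pow,
    Real.sq_sqrt (by positivity), norm_besselSymbol, Complex.norm_real,
    Real.norm_of_nonneg (by positivity)]
  have e1 : ((1 + t) ^ (-(γ / 2))) ^ 2 = ((1 + t) ^ γ)⁻¹ := by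
    rw [← Real.rpow_natCast, ← Real.rpow_mul ht1.le, ← Real.rpow_neg ht1.le]
    congr 1; push_cast; ring
  have hs : √(1 + r ^ 2) ^ 2 = 1 + r ^ 2 := Real.sq_sqrt (by positivity)
  rw [e1]
  -- Dividing the right side of the decay estimate by 1 + r² gives exactly the squared weights of
  -- the two data norms, as w is the `H¹` representative.
  have h4 : (r ^ (-γ) * (√(1 + r ^ 2))⁻¹) ^ 2 + 1 = ((r ^ (-γ)) ^ 2 + (1 + r ^ 2)) / (1 + r ^ 2) := by
    rw [mul_pow, inv_pow, hs]; field_simp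
  have h5 : (r ^ (-γ) * (√(1 + r ^ 2))⁻¹) ^ 2 + 1 ≤ (r ^ (-γ) * (√(1 + r ^ 2))⁻¹ + 1) ^ 2 := by
    have : 0 ≤ r ^ (-γ) * (√(1 + r ^ 2))⁻¹ := by positivity
    nlinarith
  have hTp : 0 < (1 + t) ^ γ := by positivity
  calc (1 + (1 + t) * r ^ 2) / (1 + r ^ 2) * ‖K0 t r‖ ^ 2
      ≤ (1 + (1 + t) * r ^ 2) / (1 + r ^ 2) * (2 * Real.exp (-(decayRate r * t))) := by gcongr
    _ = 2 * ((1 + t) ^ γ)⁻¹ * ((1 + t) ^ γ * (1 + (1 + t) * r ^ 2) *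
          Real.exp (-(decayRate r * t))) / (1 + r ^ 2) := by field_simp
    _ ≤ 2 * ((1 + t) ^ γ)⁻¹ * (C * ((r ^ (-γ)) ^ 2 + (1 + r ^ 2))) / (1 + r ^ 2) := by gcongr
    _ = 2 * C * ((1 + t) ^ γ)⁻¹ * ((r ^ (-γ) * (√(1 + r ^ 2))⁻¹) ^ 2 + 1) := by rw [h4]; ring
    _ ≤ _ := by gcongr

/-- Decay of the second fundamental solution in the weighted energy norm. -/
theorem enorm_weightOp_waveOp_le {n : ℕ} (hn : 1 ≤ n) {γ : ℝ} (hγ : 0 ≤ γ) :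
    ∃ C : ℝ, 0 < C ∧ ∀ s t : ℝ, 0 ≤ s → s ≤ t → ∀ f : L2 n,
      ‖weightOp (1 + t) (waveOp s f)‖ₑ ≤
        ENNReal.ofReal (C * √((1 + t) / (1 + s)) * (1 + s) ^ (-(γ / 2))) *
          (negSobolevNorm γ f + ‖f‖ₑ) := by
  obtain ⟨C, hC, h⟩ := weighted_decay_le hγ
  refine ⟨√(4 * C), by positivity, fun s t hs hst f => ?_⟩
  rw [← enorm_fourier f]
  refine enorm_le_of_ae_le_add (aestronglyMeasurable_negSobolev γ _) (Lp.aestronglyMeasurable _) ?_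
  filter_upwards [ae_two_pi_norm_pos hn, coeFn_mulOp (measurable_weightSymbol (1 + t))
    (norm_weightSymbol_le (1 + t)) (waveOp s f),
    coeFn_mulOp (measurable_waveSymbol s) (norm_waveSymbol_le s) (𝓕 f)] with ξ hr h1 h2
  rw [weightOp, h1, waveOp, h2]
  generalize 2 * Real.pi * ‖ξ‖ = r at hr ⊢
  rw [norm_mul, norm_mul, norm_mul, ← mul_assoc, ← add_one_mul, ← mul_assoc]
  refine mul_le_mul_of_nonneg_right ?_ (norm_nonneg _)
  have hs1 : 0 < 1 + s := by linarith
  have ht1 : 0 < 1 + t := by linarith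
  refine le_of_sq_le_sq ?_ (by positivity)
  have hdec := h s r hs hr
  have hK := norm_K1_sq_le hs r
  rw [mul_pow, norm_weightSymbol_sq ht1.le, norm_waveSymbol_sq, abs_of_nonneg hs, mul_pow, mul_pow,
    mul_pow, Real.sq_sqrt (by positivity), Real.sq_sqrt (by positivity), Complex.norm_real,
    Real.norm_of_nonneg (by positivity)]
  have e1 : ((1 + s) ^ (-(γ / 2))) ^ 2 = ((1 + s) ^ γ)⁻¹ := by
    rw [← Real.rpow_natCast, ← Real.rpow_mul hs1.le, ← Real.rpow_neg hs1.le]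
    congr 1; push_cast; ring
  rw [e1]
  have hsp : 0 < (1 + s) ^ γ := by positivity
  -- The norm carries the weight of time t but the propagator has run only for time s ≤ t;
  -- exchanging 1 + t for 1 + s costs their ratio, whose square root appears in the bound.
  have hQ : 1 + (1 + t) * r ^ 2 ≤ (1 + t) / (1 + s) * (1 + (1 + s) * r ^ 2) := by
    rw [div_mul_eq_mul_div, le_div_iff₀ hs1]
    nlinarith [sq_nonneg r]
  have hK2 : ‖K1 s r‖ ^ 2 ≤ 4 * Real.exp (-(decayRate r * s)) / (1 + r ^ 2) := by
    rw [le_div_iff₀ (by positivity)]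
    nlinarith [mul_nonneg (sq_nonneg r) (sq_nonneg ‖K1 s r‖)]
  have h6 : ((r ^ (-γ)) ^ 2 + (1 + r ^ 2)) / (1 + r ^ 2) ≤ (r ^ (-γ) + 1) ^ 2 := by
    rw [div_le_iff₀ (by positivity)]
    have h7 : 0 ≤ r ^ (-γ) := by positivity
    nlinarith [mul_nonneg (sq_nonneg (r ^ (-γ))) (sq_nonneg r),
      mul_nonneg h7 (sq_nonneg r), sq_nonneg r]
  have e2 : (1 + (1 + t) * r ^ 2) / (1 + r ^ 2) * ((1 + r ^ 2) * ‖K1 s r‖ ^ 2) =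
      (1 + (1 + t) * r ^ 2) * ‖K1 s r‖ ^ 2 := by field_simp
  rw [e2]
  calc (1 + (1 + t) * r ^ 2) * ‖K1 s r‖ ^ 2
      ≤ ((1 + t) / (1 + s) * (1 + (1 + s) * r ^ 2)) *
          (4 * Real.exp (-(decayRate r * s)) / (1 + r ^ 2)) := by gcongr
    _ = 4 * ((1 + t) / (1 + s)) * ((1 + s) ^ γ)⁻¹ * (((1 + s) ^ γ * (1 + (1 + s) * r ^ 2) *
          Real.exp (-(decayRate r * s))) / (1 + r ^ 2)) := by field_simp
    _ ≤ 4 * ((1 + t) / (1 + s)) * ((1 + s) ^ γ)⁻¹ *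
          ((C * ((r ^ (-γ)) ^ 2 + (1 + r ^ 2))) / (1 + r ^ 2)) := by gcongr
    _ = 4 * C * ((1 + t) / (1 + s)) * ((1 + s) ^ γ)⁻¹ *
          (((r ^ (-γ)) ^ 2 + (1 + r ^ 2)) / (1 + r ^ 2)) := by ring
    _ ≤ _ := by gcongr

theorem negSobolevNorm_zero {n : ℕ} (f : L2 n) : negSobolevNorm 0 f = ‖f‖ₑ := by
  rw [negSobolevNorm, ← enorm_fourier]
  simp

/-- The case γ = 0 of the previous decay estimate, used when the source, rather than the propagator,
supplies the decay. The two norms of the data coincide, hence the factor 2. -/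
theorem norm_weightOp_waveOp_le {n : ℕ} (hn : 1 ≤ n) :
    ∃ C : ℝ, 0 < C ∧ ∀ s t : ℝ, 0 ≤ s → s ≤ t → ∀ f : L2 n,
      ‖weightOp (1 + t) (waveOp s f)‖ ≤ C * √((1 + t) / (1 + s)) * ‖f‖ := by
  obtain ⟨C, hC, h⟩ := enorm_weightOp_waveOp_le hn le_rfl
  refine ⟨C * 2, by positivity, fun s t hs hst f => ?_⟩
  have h1 := h s t hs hst f
  rw [negSobolevNorm_zero, ← ofReal_norm, ← ofReal_norm, ← ENNReal.ofReal_add (norm_nonneg _)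
    (norm_nonneg _), ← ENNReal.ofReal_mul (by positivity)] at h1
  rw [ENNReal.ofReal_le_ofReal_iff (by positivity)] at h1
  refine h1.trans (le_of_eq ?_)
  simp
  ring

/-- The Gagliardo-Nirenberg inequality in the weighted energy norm. -/
theorem eLpNorm_toH1_le {n : ℕ} (hn : 1 ≤ n) {q s : ℝ} (hq : 2 ≤ q)
    (hs : s = n * (1 / 2 - 1 / q)) (hs1 : s ≤ 1) :
    ∃ C : ℝ, 0 < C ∧ ∀ R : ℝ, 0 < R → ∀ w : L2 n, eLpNorm (toH1 w) (ENNReal.ofReal q) ≤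
      ENNReal.ofReal (C * R ^ (-(s / 2)) * ‖weightOp R w‖) := by
  obtain ⟨C, hC, h⟩ : ∃ C : ℝ, 0 < C ∧ ∀ f : L2 n, eLpNorm f (ENNReal.ofReal q) ≤
      ENNReal.ofReal C * eLpNorm (fun ξ : Rn n => ((‖ξ‖ ^ s : ℝ) : ℂ) * (𝓕 f : L2 n) ξ) 2 := by
    -- The Sobolev embedding needs q > 2; at q = 2 it is Plancherel's identity.
    rcases hq.eq_or_lt with hq | hq
    · refine ⟨1, one_pos, fun f => ?_⟩
      have hs0 : s = 0 := by rw [hs, ← hq]; simp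
      simp [hs0, ← hq, enorm_fourier, Lp.enorm_def]
    · exact sobolev_embedding hn hq hs
  have hs0 : 0 ≤ s := by
    rw [hs]
    have : 1 / q ≤ 1 / 2 := one_div_le_one_div_of_le two_pos hq
    exact mul_nonneg (Nat.cast_nonneg _) (by linarith)
  refine ⟨C, hC, fun R hR w => (h _).trans ?_⟩
  rw [mul_assoc, ENNReal.ofReal_mul hC.le, ENNReal.ofReal_mul (by positivity), ofReal_norm,
    Lp.enorm_def]
  gcongr
  refine eLpNorm_le_mul_eLpNorm_of_ae_le_mul ?_ 2
  filter_upwards [coeFn_mulOp (measurable_weightSymbol R) (norm_weightSymbol_le R) w,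
    coeFn_mulOp measurable_besselSymbol norm_besselSymbol_le w] with ξ h1 h2
  rw [fourier_toH1, h2, weightOp, h1, norm_mul, norm_mul, norm_mul, ← mul_assoc, ← mul_assoc,
    norm_weightSymbol, norm_besselSymbol, Complex.norm_real, Real.norm_of_nonneg (by positivity),
    abs_of_pos hR]
  set r := 2 * Real.pi * ‖ξ‖ with hr
  refine mul_le_mul_of_nonneg_right ?_ (norm_nonneg _)
  have hr1 : ‖ξ‖ ≤ r := by
    rw [hr]
    exact le_mul_of_one_le_left (norm_nonneg _) (by linarith [Real.pi_gt_three])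
  rw [Real.sqrt_div (by positivity), ← mul_div_assoc, ← div_eq_mul_inv]
  refine div_le_div_of_nonneg_right ?_ (by positivity)
  have hr0 : 0 ≤ r := (norm_nonneg _).trans hr1
  have h3 : ‖ξ‖ ^ s ≤ r ^ s := Real.rpow_le_rpow (norm_nonneg _) hr1 hs0
  -- Interpolation is done on the symbol: (R r²)^{s/2} ≤ (1 + R r²)^{1/2} because s ≤ 1, and the
  -- leftover power of R is the gain in time.
  have e : r ^ s = R ^ (-(s / 2)) * (R * r ^ 2) ^ (s / 2) := by
    rw [Real.mul_rpow hR.le (by positivity), ← mul_assoc, ← Real.rpow_add hR, ← Real.rpow_natCast,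
      ← Real.rpow_mul hr0]
    norm_num
    congr 1; ring
  refine h3.trans ?_
  rw [e]
  gcongr
  rw [Real.sqrt_eq_rpow]
  calc (R * r ^ 2) ^ (s / 2) ≤ (1 + R * r ^ 2) ^ (s / 2) :=
        Real.rpow_le_rpow (by positivity) (by linarith) (by positivity)
    _ ≤ (1 + R * r ^ 2) ^ ((1 : ℝ) / 2) :=
        Real.rpow_le_rpow_of_exponent_le (by nlinarith [sq_nonneg r]) (by linarith)

/-! ### The nonlinearity -/

/-- Bernoulli's inequality at x/y - 1, multiplied by y^p. -/
theorem rpow_sub_rpow_le {p x y : ℝ} (hp : 1 ≤ p) (hx : 0 ≤ x) (hxy : x ≤ y) :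
    y ^ p - x ^ p ≤ p * y ^ (p - 1) * (y - x) := by
  rcases (hx.trans hxy).eq_or_lt with hy | hy
  · have : x = 0 := le_antisymm (hxy.trans hy.ge) hx
    simp [this, ← hy]
  · have h := one_add_mul_self_le_rpow_one_add (s := x / y - 1) (p := p)
      (by have : 0 ≤ x / y := by positivity
          linarith) hp
    rw [add_sub_cancel, Real.div_rpow hx hy.le, le_div_iff₀ (by positivity)] at h
    have e : y ^ p = y ^ (p - 1) * y := by
      rw [← Real.rpow_add_one hy.ne']; ring_nf
    have e2 : (1 + p * (x / y - 1)) * y ^ p = y ^ p - p * y ^ (p - 1) * (y - x) := by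
      rw [e]; field_simp; ring
    linarith

theorem abs_rpow_sub_rpow_le {p x y : ℝ} (hp : 1 ≤ p) (hx : 0 ≤ x) (hy : 0 ≤ y) :
    |x ^ p - y ^ p| ≤ p * (x ^ (p - 1) + y ^ (p - 1)) * |x - y| := by
  have key : ∀ x y : ℝ, 0 ≤ x → x ≤ y →
      |x ^ p - y ^ p| ≤ p * (x ^ (p - 1) + y ^ (p - 1)) * |x - y| := by
    intro x y hx hxy
    have hy := hx.trans hxy
    rw [abs_sub_comm, abs_of_nonneg (sub_nonneg.2 (Real.rpow_le_rpow hx hxy (by linarith))),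
      abs_sub_comm, abs_of_nonneg (sub_nonneg.2 hxy)]
    refine (rpow_sub_rpow_le hp hx hxy).trans ?_
    have h1 : 0 ≤ x ^ (p - 1) := by positivity
    have h2 : 0 ≤ y - x := sub_nonneg.2 hxy
    gcongr
    linarith
  rcases le_total x y with h | h
  · exact key x y hx h
  · rw [abs_sub_comm, abs_sub_comm x y, add_comm]
    exact key y x hy h

theorem eLpNorm_ofReal_norm_rpow {n : ℕ} {p q : ℝ} (hp : 0 < p) (hq : 0 ≤ q) (f : Rn n → ℂ) :
    eLpNorm (fun x => ((‖f x‖ ^ p : ℝ) : ℂ)) (ENNReal.ofReal q) volume =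
      eLpNorm f (ENNReal.ofReal (q * p)) volume ^ p := by
  rw [ENNReal.ofReal_mul hq, ← eLpNorm_norm_rpow f hp]
  exact eLpNorm_congr_norm_ae (.of_forall fun x => by simp)

theorem aestronglyMeasurable_ofReal_norm_rpow {n : ℕ} (p : ℝ) (f : L2 n) :
    AEStronglyMeasurable (fun x => ((‖f x‖ ^ p : ℝ) : ℂ)) volume :=
  (Complex.measurable_ofReal.comp
    ((Lp.stronglyMeasurable f).measurable.norm.pow_const p)).aestronglyMeasurable

open Classical in
/-- `|u|^p` as an element of `L²`, for `u = toH1 w`. -/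
def powOp {n : ℕ} (p : ℝ) (w : L2 n) : L2 n :=
  if h : MemLp (fun x => ((‖toH1 w x‖ ^ p : ℝ) : ℂ)) 2 volume then h.toLp _ else 0

/-- The Sobolev exponent condition `H¹ ⊂ L^{2p}`. -/
def SobolevSubcritical (n : ℕ) (p : ℝ) : Prop := (n : ℝ) * (1 / 2 - 1 / (2 * p)) ≤ 1

theorem coeFn_powOp {n : ℕ} (hn : 1 ≤ n) {p : ℝ} (hp : 1 < p) (hs : SobolevSubcritical n p)
    (w : L2 n) : powOp p w =ᵐ[volume] fun x => ((‖toH1 w x‖ ^ p : ℝ) : ℂ) := by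
  have h : MemLp (fun x => ((‖toH1 w x‖ ^ p : ℝ) : ℂ)) 2 volume := by
    refine ⟨aestronglyMeasurable_ofReal_norm_rpow p _, ?_⟩
    obtain ⟨C, hC, h⟩ := eLpNorm_toH1_le hn (q := 2 * p) (by linarith) rfl hs
    have := eLpNorm_ofReal_norm_rpow (p := p) (q := 2) (by linarith) (by norm_num) (toH1 w)
    rw [ENNReal.ofReal_ofNat] at this
    rw [this]
    exact ENNReal.rpow_lt_top_of_nonneg (by linarith)
      ((h 1 one_pos w).trans_lt ENNReal.ofReal_lt_top).ne
  rw [powOp, dif_pos h]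
  exact h.coeFn_toLp

theorem eLpNorm_powOp {n : ℕ} (hn : 1 ≤ n) {p : ℝ} (hp : 1 < p) (hs : SobolevSubcritical n p)
    {q : ℝ} (hq : 0 ≤ q) (w : L2 n) :
    eLpNorm (powOp p w) (ENNReal.ofReal q) volume =
      eLpNorm (toH1 w) (ENNReal.ofReal (q * p)) volume ^ p := by
  rw [eLpNorm_congr_ae (coeFn_powOp hn hp hs w), eLpNorm_ofReal_norm_rpow (by linarith) hq]

theorem eLpNorm_toH1_le_norm {n : ℕ} (hn : 1 ≤ n) {p : ℝ} (hp : 1 < p)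
    (hs : SobolevSubcritical n p) :
    ∃ C : ℝ, 0 < C ∧ ∀ w : L2 n, eLpNorm (toH1 w) (ENNReal.ofReal (2 * p)) ≤
      ENNReal.ofReal (C * ‖w‖) := by
  obtain ⟨C, hC, h⟩ := eLpNorm_toH1_le hn (q := 2 * p) (by linarith) rfl hs
  refine ⟨C * √2, by positivity, fun w => (h 1 one_pos w).trans (ENNReal.ofReal_le_ofReal ?_)⟩
  rw [Real.one_rpow, mul_one, mul_assoc]
  gcongr
  refine (norm_weightOp_le 1 w).trans (le_of_eq ?_)
  norm_num

/-- Hölder with exponents 2p/(p - 1) and 2p, which combine to 2, applied to the pointwise bound of |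
|u|^p - |v|^p |; both factors are controlled by `H¹ ⊂ L^{2p}`. -/
theorem powOp_lipschitz {n : ℕ} (hn : 1 ≤ n) {p : ℝ} (hp : 1 < p) (hs : SobolevSubcritical n p)
    (M : ℝ) : ∃ L : ℝ, 0 ≤ L ∧ ∀ w ∈ Metric.closedBall (0 : L2 n) M,
      ∀ v ∈ Metric.closedBall (0 : L2 n) M, ‖powOp p w - powOp p v‖ ≤ L * ‖w - v‖ := by
  obtain ⟨C, hC, h⟩ := eLpNorm_toH1_le_norm hn hp hs
  have hp0 : 0 < p := by linarith
  have hp1 : 0 < p - 1 := by linarith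
  refine ⟨p * (2 * (C * |M|) ^ (p - 1)) * C, by positivity, fun w hw v hv => ?_⟩
  rw [mem_closedBall_zero_iff] at hw hv
  set φ : Rn n → ℝ := fun x => ‖toH1 w x‖ ^ (p - 1) + ‖toH1 v x‖ ^ (p - 1) with hφ
  have hm : ∀ w : L2 n, AEStronglyMeasurable (fun x => ‖toH1 w x‖ ^ (p - 1)) volume := fun w =>
    ((Lp.stronglyMeasurable (toH1 w)).measurable.norm.pow_const (p - 1)).aestronglyMeasurable
  have hφm : AEStronglyMeasurable φ volume := (hm w).add (hm v)
  have hpw : ∀ w : L2 n, ‖w‖ ≤ M → eLpNorm (fun x => ‖toH1 w x‖ ^ (p - 1))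
      (ENNReal.ofReal (2 * p / (p - 1))) volume ≤ ENNReal.ofReal ((C * |M|) ^ (p - 1)) := by
    intro w hw
    rw [eLpNorm_norm_rpow _ hp1, ← ENNReal.ofReal_mul (by positivity),
      div_mul_cancel₀ _ hp1.ne', ← ENNReal.ofReal_rpow_of_nonneg (by positivity) hp1.le]
    refine ENNReal.rpow_le_rpow ((h w).trans (ENNReal.ofReal_le_ofReal ?_)) hp1.le
    gcongr
    exact hw.trans (le_abs_self M)
  have hφn : eLpNorm φ (ENNReal.ofReal (2 * p / (p - 1))) volume ≤
      ENNReal.ofReal (2 * (C * |M|) ^ (p - 1)) := by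
    refine (eLpNorm_add_le (hm w) (hm v) ?_).trans ?_
    · rw [ENNReal.one_le_ofReal, le_div_iff₀ hp1]; linarith
    · rw [two_mul ((C * |M|) ^ (p - 1)), ENNReal.ofReal_add (by positivity) (by positivity)]
      exact add_le_add (hpw w hw) (hpw v hv)
  have hH : ENNReal.HolderTriple (ENNReal.ofReal (2 * p / (p - 1))) (ENNReal.ofReal (2 * p)) 2 := by
    constructor
    rw [← ENNReal.ofReal_inv_of_pos (by positivity), ← ENNReal.ofReal_inv_of_pos (by positivity),
      ← ENNReal.ofReal_add (by positivity) (by positivity), ← ENNReal.ofReal_ofNat 2,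
      ← ENNReal.ofReal_inv_of_pos (by positivity)]
    congr 1
    field_simp
    ring
  have hHo := eLpNorm_smul_le_mul_eLpNorm (p := ENNReal.ofReal (2 * p / (p - 1)))
    (q := ENNReal.ofReal (2 * p)) (r := 2) (Lp.aestronglyMeasurable (toH1 (w - v))) hφm
  have h1 : ‖powOp p w - powOp p v‖ₑ ≤ ENNReal.ofReal p *
      eLpNorm (φ • (toH1 (w - v) : Rn n → ℂ)) 2 volume := by
    rw [Lp.enorm_def]
    refine eLpNorm_le_mul_eLpNorm_of_ae_le_mul ?_ 2
    have e : toH1 (w - v) = toH1 w - toH1 v := map_sub _ _ _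
    rw [e]
    filter_upwards [coeFn_powOp hn hp hs w, coeFn_powOp hn hp hs v,
      Lp.coeFn_sub (powOp p w) (powOp p v), Lp.coeFn_sub (toH1 w) (toH1 v)] with x h1 h2 h3 h4
    rw [h3, Pi.sub_apply, h1, h2, Pi.smul_apply', h4, Pi.sub_apply, norm_smul,
      ← Complex.ofReal_sub, Complex.norm_real, Real.norm_eq_abs,
      Real.norm_of_nonneg (by positivity), ← mul_assoc]
    refine (abs_rpow_sub_rpow_le hp.le (norm_nonneg _) (norm_nonneg _)).trans ?_
    gcongr
    exact abs_norm_sub_norm_le _ _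
  have h2 : ‖powOp p w - powOp p v‖ₑ ≤
      ENNReal.ofReal (p * (2 * (C * |M|) ^ (p - 1)) * C * ‖w - v‖) := by
    refine h1.trans ?_
    rw [mul_assoc, mul_assoc, ENNReal.ofReal_mul hp0.le, ENNReal.ofReal_mul (by positivity)]
    gcongr
    exact hHo.trans (mul_le_mul' hφn (h _))
  rw [← ofReal_norm, ENNReal.ofReal_le_ofReal_iff (by positivity)] at h2
  exact h2

theorem continuous_powOp {n : ℕ} (hn : 1 ≤ n) {p : ℝ} (hp : 1 < p) (hs : SobolevSubcritical n p) :
    Continuous (powOp p : L2 n → L2 n) := by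
  rw [continuous_iff_continuousAt]
  intro w
  obtain ⟨L, hL, h⟩ := powOp_lipschitz hn hp hs (‖w‖ + 1)
  have hnb : Metric.closedBall (0 : L2 n) (‖w‖ + 1) ∈ 𝓝 w := by
    refine mem_of_superset (Metric.closedBall_mem_nhds w one_pos) fun v hv => ?_
    rw [mem_closedBall_zero_iff]
    rw [mem_closedBall_iff_norm] at hv
    calc ‖v‖ = ‖w + (v - w)‖ := by rw [add_sub_cancel]
      _ ≤ _ := (norm_add_le _ _).trans (by gcongr)
  have hlip : LipschitzOnWith L.toNNReal (powOp p) (Metric.closedBall (0 : L2 n) (‖w‖ + 1)) :=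
    LipschitzOnWith.of_dist_le_mul fun x hx y hy => by
      rw [dist_eq_norm, dist_eq_norm, Real.coe_toNNReal _ hL]
      exact h x hx y hy
  exact hlip.continuousOn.continuousAt hnb

theorem negSobolevNorm_le {n : ℕ} (hn : 1 ≤ n) {γ m : ℝ} (hm : 1 < m) (hm2 : m < 2)
    (hγ : γ = n * (1 / m - 1 / 2)) :
    ∃ C : ℝ, 0 < C ∧ ∀ f : L2 n,
      negSobolevNorm γ f ≤ ENNReal.ofReal C * eLpNorm f (ENNReal.ofReal m) := by
  obtain ⟨C, hC, h⟩ := eLpNorm_rpow_neg_mul_fourier_le hn hm hm2 hγ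
  refine ⟨C, hC, fun f => le_trans ?_ (h f)⟩
  have hγ0 : 0 ≤ γ := by
    rw [hγ]
    have : 1 / 2 ≤ 1 / m := one_div_le_one_div_of_le (by linarith) hm2.le
    exact mul_nonneg (Nat.cast_nonneg _) (by linarith)
  refine eLpNorm_mono_ae ?_
  filter_upwards [ae_two_pi_norm_pos hn] with ξ hξ
  have hξ' : 0 < ‖ξ‖ := pos_of_mul_pos_right hξ (by positivity)
  rw [norm_mul, norm_mul, Complex.norm_real, Complex.norm_real,
    Real.norm_of_nonneg (by positivity), Real.norm_of_nonneg (by positivity)]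
  refine mul_le_mul_of_nonneg_right ?_ (norm_nonneg _)
  refine Real.rpow_le_rpow_of_nonpos hξ' ?_ (by linarith)
  exact le_mul_of_one_le_left (norm_nonneg _) (by linarith [Real.pi_gt_three])

/-- Bounds for `|u|^p` in `L²` and in `Ḣ^{-γ}` along the decay rate of the linear problem. -/
theorem powOp_weighted_le {n : ℕ} (hn : 1 ≤ n) {γ p : ℝ} (hγ : 0 < γ) (hγ' : γ < n / 2)
    (hp : 1 < p) (hs : SobolevSubcritical n p) (hpl : 1 + 2 * γ / n ≤ p) :
    ∃ C : ℝ, 0 < C ∧ ∀ τ M : ℝ, 0 ≤ τ → 0 ≤ M → ∀ w : L2 n,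
      ‖weightOp (1 + τ) w‖ ≤ M * (1 + τ) ^ (-(γ / 2)) →
      ‖powOp p w‖ ≤ C * M ^ p * (1 + τ) ^ (-((p - 1) * (n + 2 * γ) / 4) - γ / 2) ∧
      negSobolevNorm γ (powOp p w) ≤
        ENNReal.ofReal (C * M ^ p * (1 + τ) ^ (-((p - 1) * (n + 2 * γ) / 4))) := by
  have hn0 : (0 : ℝ) < n := by exact_mod_cast hn
  have hp0 : 0 < p := by linarith
  -- The exponent dual to the Sobolev one, so that `L^m ⊂ Ḣ^{-γ}`; the bounds on γ give 1 < m < 2.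
  set m : ℝ := 2 * n / (n + 2 * γ) with hm
  have hmp : 0 < m := by positivity
  have hm1 : 1 < m := by rw [hm, lt_div_iff₀ (by positivity)]; linarith
  have hm2 : m < 2 := by rw [hm, div_lt_iff₀ (by positivity)]; linarith
  have hminv : 1 / m = 1 / 2 + γ / n := by rw [hm]; field_simp
  obtain ⟨C₁, hC₁, h₁⟩ := eLpNorm_toH1_le hn (q := 2 * p) (by linarith) rfl hs
  -- The lower bound on p is exactly what makes `L^{mp}` reachable from the energy norm. Since m <
  -- 2, the Sobolev order needed for `L^{mp}` is no larger than that for `L^{2p}`.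
  have hmp2 : 2 ≤ m * p := by
    calc (2 : ℝ) = m * (1 + 2 * γ / n) := by rw [hm]; field_simp
      _ ≤ m * p := by gcongr
  obtain ⟨C₂, hC₂, h₂⟩ := eLpNorm_toH1_le hn (q := m * p) hmp2 rfl (by
    refine le_trans ?_ hs
    gcongr)
  obtain ⟨C₃, hC₃, h₃⟩ := negSobolevNorm_le hn hm1 hm2 (γ := γ) (by rw [hminv]; field_simp; ring)
  have main : ∀ (K : ℝ), 0 < K → ∀ s : ℝ, ∀ τ M : ℝ, 0 ≤ τ → 0 ≤ M → ∀ w : L2 n,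
      ‖weightOp (1 + τ) w‖ ≤ M * (1 + τ) ^ (-(γ / 2)) →
      ENNReal.ofReal (K * (1 + τ) ^ (-(s / 2)) * ‖weightOp (1 + τ) w‖) ^ p ≤
        ENNReal.ofReal (K ^ p * M ^ p * (1 + τ) ^ (-(p * (γ + s) / 2))) := by
    intro K hK s τ M hτ hM w hw
    have hτ1 : 0 < 1 + τ := by linarith
    rw [ENNReal.ofReal_rpow_of_nonneg (by positivity) hp0.le]
    apply ENNReal.ofReal_le_ofReal
    calc (K * (1 + τ) ^ (-(s / 2)) * ‖weightOp (1 + τ) w‖) ^ p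
        ≤ (K * (1 + τ) ^ (-(s / 2)) * (M * (1 + τ) ^ (-(γ / 2)))) ^ p := by gcongr
      _ = (K * M * (1 + τ) ^ (-((γ + s) / 2))) ^ p := by
          congr 1
          rw [show -((γ + s) / 2) = -(s / 2) + -(γ / 2) by ring, Real.rpow_add hτ1]
          ring
      _ = _ := by
          rw [Real.mul_rpow (by positivity) (by positivity), Real.mul_rpow hK.le hM,
            ← Real.rpow_mul hτ1.le]
          congr 2
          ring
  refine ⟨C₁ ^ p + C₃ * C₂ ^ p, by positivity, fun τ M hτ hM w hw => ⟨?_, ?_⟩⟩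
  · have hτ1 : 0 < 1 + τ := by linarith
    have e := eLpNorm_powOp hn hp hs (q := 2) (by norm_num) w
    rw [ENNReal.ofReal_ofNat, ← Lp.enorm_def] at e
    have h4 : ‖powOp p w‖ₑ ≤ _ := e.le.trans ((ENNReal.rpow_le_rpow (h₁ _ hτ1 w) hp0.le).trans
      (main C₁ hC₁ _ τ M hτ hM w hw))
    rw [← ofReal_norm, ENNReal.ofReal_le_ofReal_iff (by positivity)] at h4
    have e2 : -(p * (γ + n * (1 / 2 - 1 / (2 * p))) / 2) =
        -((p - 1) * (n + 2 * γ) / 4) - γ / 2 := by field_simp; ring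
    rw [e2] at h4
    refine h4.trans ?_
    gcongr
    have : 0 ≤ C₃ * C₂ ^ p := by positivity
    linarith
  · have hτ1 : 0 < 1 + τ := by linarith
    have e := eLpNorm_powOp hn hp hs (q := m) hmp.le w
    have h4 := e.le.trans ((ENNReal.rpow_le_rpow (h₂ _ hτ1 w) hp0.le).trans
      (main C₂ hC₂ _ τ M hτ hM w hw))
    have e2 : -(p * (γ + n * (1 / 2 - 1 / (m * p))) / 2) = -((p - 1) * (n + 2 * γ) / 4) := by
      rw [show 1 / (m * p) = 1 / m * (1 / p) by rw [one_div_mul_one_div], hminv]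
      field_simp; ring
    rw [e2] at h4
    refine (h₃ _).trans ((mul_le_mul' le_rfl h4).trans ?_)
    rw [← ENNReal.ofReal_mul hC₃.le]
    apply ENNReal.ofReal_le_ofReal
    rw [← mul_assoc, ← mul_assoc]
    gcongr
    have : 0 ≤ C₁ ^ p := by positivity
    linarith

/-! ### The Duhamel term -/

theorem integral_one_add_rpow_le {b : ℝ} (hb : b < 1) (t : ℝ) :
    ∫ τ in (0 : ℝ)..t, (1 + τ) ^ (-b) ≤ (1 + t) ^ (1 - b) / (1 - b) := by
  have h := intervalIntegral.integral_comp_add_left (a := 0) (b := t)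
    (fun x : ℝ => x ^ (-b)) 1
  rw [h, integral_rpow (.inl (by linarith))]
  rw [show -b + 1 = 1 - b by ring, add_zero, Real.one_rpow]
  have : 0 < 1 - b := by linarith
  gcongr
  linarith

theorem intervalIntegrable_one_add_rpow {b t : ℝ} (ht : 0 ≤ t) :
    IntervalIntegrable (fun τ : ℝ => (1 + τ) ^ (-b)) volume 0 t := by
  apply ContinuousOn.intervalIntegrable
  rw [uIcc_of_le ht]
  refine ContinuousOn.rpow_const (by fun_prop) fun τ hτ => .inl ?_
  have := hτ.1
  positivity

theorem integral_one_add_sub_rpow (b t : ℝ) :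
    ∫ τ in (0 : ℝ)..t, (1 + (t - τ)) ^ (-b) = ∫ τ in (0 : ℝ)..t, (1 + τ) ^ (-b) := by
  simpa using intervalIntegral.integral_comp_sub_left (a := 0) (b := t)
    (fun x : ℝ => (1 + x) ^ (-b)) t

theorem duhamel_integrand_le {n : ℕ} (hn : 1 ≤ n) {γ p : ℝ} (hγ : 0 < γ) (hγ' : γ < n / 2)
    (hp : 1 < p) (hs : SobolevSubcritical n p) (hpl : 1 + 2 * γ / n ≤ p) {b : ℝ}
    (hb : b = (p - 1) * (n + 2 * γ) / 4) :
    ∃ C : ℝ, 0 < C ∧ ∀ τ t M : ℝ, 0 ≤ τ → τ ≤ t → 0 ≤ M → ∀ w : L2 n,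
      ‖weightOp (1 + τ) w‖ ≤ M * (1 + τ) ^ (-(γ / 2)) →
      ‖weightOp (1 + t) (waveOp (t - τ) (powOp p w))‖ ≤
        C * M ^ p * (1 + t) ^ (-(γ / 2)) *
          ((1 + τ) ^ (-b) + (1 + t) ^ (1 / 2 - b) * (1 + (t - τ)) ^ (-(1 / 2 : ℝ))) := by
  obtain ⟨C₁, hC₁, h₁⟩ := powOp_weighted_le hn hγ hγ' hp hs hpl
  obtain ⟨C₂, hC₂, h₂⟩ := enorm_weightOp_waveOp_le hn hγ.le
  obtain ⟨C₃, hC₃, h₃⟩ := norm_weightOp_waveOp_le hn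
  rw [← hb] at h₁
  have hb0 : 0 ≤ b := by
    rw [hb]
    have : 0 < p - 1 := by linarith
    positivity
  set A : ℝ := C₂ * √2 * 2 ^ (γ / 2) * (2 * C₁) with hA
  set B : ℝ := C₃ * C₁ * 2 ^ (b + γ / 2) with hB
  have hApos : 0 < A := by positivity
  have hBpos : 0 < B := by positivity
  refine ⟨A + B, by positivity, fun τ t M hτ hτt hM w hw => ?_⟩
  obtain ⟨hL2, hneg⟩ := h₁ τ M hτ hM w hw
  have hτ1 : 0 < 1 + τ := by linarith
  have ht1 : 0 < 1 + t := by linarith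
  set s := t - τ with hsdef
  have hs0 : 0 ≤ s := by linarith
  have hs1 : 0 < 1 + s := by linarith
  have hst : s ≤ t := by linarith
  have hdown : ∀ x c : ℝ, 0 ≤ c → (1 + t) / 2 ≤ x → x ^ (-c) ≤ 2 ^ c * (1 + t) ^ (-c) := by
    intro x c hc hx
    refine (Real.rpow_le_rpow_of_nonpos (by positivity) hx (by linarith)).trans (le_of_eq ?_)
    rw [Real.div_rpow ht1.le two_pos.le, Real.rpow_neg two_pos.le]
    field_simp
  have hP1 : 0 ≤ (1 + τ) ^ (-b) := by positivity
  have hP2 : 0 ≤ (1 + t) ^ (1 / 2 - b) * (1 + s) ^ (-(1 / 2 : ℝ)) := by positivity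
  have hG : 0 ≤ M ^ p * (1 + t) ^ (-(γ / 2)) := by positivity
  -- Early sources, τ ≤ t/2: the propagator has run for at least t/2 and supplies (1 + t)^{-γ/2}
  -- through the `Ḣ^{-γ}` estimate. For late sources, τ ≥ t/2, the `L²` estimate is used and the
  -- decay of |u(τ)|^p itself is of the order of a power of 1 + t.
  rcases le_total τ s with hcase | hcase
  · have h4 := h₂ s t hs0 hst (powOp p w)
    have hsum : negSobolevNorm γ (powOp p w) + ‖powOp p w‖ₑ ≤
        ENNReal.ofReal (2 * C₁ * M ^ p * (1 + τ) ^ (-b)) := by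
      have e : 2 * C₁ * M ^ p * (1 + τ) ^ (-b) =
        C₁ * M ^ p * (1 + τ) ^ (-b) + C₁ * M ^ p * (1 + τ) ^ (-b) := by ring
      rw [e, ENNReal.ofReal_add (by positivity) (by positivity)]
      refine add_le_add hneg ?_
      rw [← ofReal_norm]
      refine ENNReal.ofReal_le_ofReal (hL2.trans ?_)
      gcongr
      · linarith
      · linarith
    have h5 := h4.trans (mul_le_mul' le_rfl hsum)
    rw [← ENNReal.ofReal_mul (by positivity), ← ofReal_norm,
      ENNReal.ofReal_le_ofReal_iff (by positivity)] at h5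
    have hQ : √((1 + t) / (1 + s)) ≤ √2 := by
      apply Real.sqrt_le_sqrt
      rw [div_le_iff₀ hs1]; linarith
    have h6 := hdown (1 + s) (γ / 2) (by positivity) (by linarith)
    calc _ ≤ _ := h5
      _ ≤ C₂ * √2 * (2 ^ (γ / 2) * (1 + t) ^ (-(γ / 2))) * (2 * C₁ * M ^ p * (1 + τ) ^ (-b)) := by
          gcongr
      _ = A * (M ^ p * (1 + t) ^ (-(γ / 2))) * (1 + τ) ^ (-b) := by rw [hA]; ring
      _ ≤ (A + B) * (M ^ p * (1 + t) ^ (-(γ / 2))) *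
          ((1 + τ) ^ (-b) + (1 + t) ^ (1 / 2 - b) * (1 + s) ^ (-(1 / 2 : ℝ))) := by
          gcongr <;> linarith
      _ = _ := by ring
  · have h4 := h₃ s t hs0 hst (powOp p w)
    have h6 := hdown (1 + τ) (b + γ / 2) (by positivity) (by linarith)
    have e1 : (1 + τ) ^ (-b - γ / 2) = (1 + τ) ^ (-(b + γ / 2)) := by congr 1; ring
    rw [e1] at hL2
    have e2 : √((1 + t) / (1 + s)) = (1 + t) ^ (1 / 2 : ℝ) * (1 + s) ^ (-(1 / 2 : ℝ)) := by
      rw [Real.sqrt_div ht1.le, Real.sqrt_eq_rpow, Real.sqrt_eq_rpow, Real.rpow_neg hs1.le,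
        div_eq_mul_inv]
    have e3 : (1 + t) ^ (1 / 2 : ℝ) * (1 + t) ^ (-(b + γ / 2)) =
        (1 + t) ^ (-(γ / 2)) * (1 + t) ^ (1 / 2 - b) := by
      rw [← Real.rpow_add ht1, ← Real.rpow_add ht1]; congr 1; ring
    calc _ ≤ _ := h4
      _ ≤ C₃ * √((1 + t) / (1 + s)) * (C₁ * M ^ p * (2 ^ (b + γ / 2) * (1 + t) ^ (-(b + γ / 2)))) := by
          refine mul_le_mul_of_nonneg_left (hL2.trans ?_) (by positivity)
          gcongr
      _ = B * M ^ p * ((1 + t) ^ (1 / 2 : ℝ) * (1 + t) ^ (-(b + γ / 2))) * (1 + s) ^ (-(1 / 2 : ℝ)) := by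
          rw [hB, e2]; ring
      _ = B * (M ^ p * (1 + t) ^ (-(γ / 2))) * ((1 + t) ^ (1 / 2 - b) * (1 + s) ^ (-(1 / 2 : ℝ))) := by
          rw [e3]; ring
      _ ≤ (A + B) * (M ^ p * (1 + t) ^ (-(γ / 2))) *
          ((1 + τ) ^ (-b) + (1 + t) ^ (1 / 2 - b) * (1 + s) ^ (-(1 / 2 : ℝ))) := by
          gcongr <;> linarith
      _ = _ := by ring

theorem continuous_uncurry_waveOp_powOp {n : ℕ} (hn : 1 ≤ n) {p : ℝ} (hp : 1 < p)
    (hs : SobolevSubcritical n p) :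
    Continuous (Function.uncurry fun (t : ℝ) (w : L2 n) => waveOp t (powOp p w)) :=
  continuous_uncurry_waveOp.comp
    (continuous_fst.prodMk ((continuous_powOp hn hp hs).comp continuous_snd))

theorem waveOp_powOp_lipschitz {n : ℕ} (hn : 1 ≤ n) {p : ℝ} (hp : 1 < p)
    (hs : SobolevSubcritical n p) (M : ℝ) :
    ∃ L : ℝ, 0 ≤ L ∧ ∀ t : ℝ, ∀ w ∈ Metric.closedBall (0 : L2 n) M,
      ∀ v ∈ Metric.closedBall (0 : L2 n) M,
        ‖waveOp t (powOp p w) - waveOp t (powOp p v)‖ ≤ L * ‖w - v‖ := by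
  obtain ⟨L, hL, h⟩ := powOp_lipschitz hn hp hs M
  refine ⟨2 * L, by positivity, fun t w hw v hv => (norm_waveOp_sub_le t _ _).trans ?_⟩
  rw [mul_assoc]
  gcongr
  exact h w hw v hv

/-- Both terms of the integrand bound integrate to a multiple of (1 + t)^{1-b}: the first because b
< 1, the second because (1 + s)^{-1/2} has integral at most 2 (1 + t)^{1/2}. -/
theorem norm_weightOp_duhamel_le {n : ℕ} (hn : 1 ≤ n) {γ p : ℝ} (hγ : 0 < γ) (hγ' : γ < n / 2)
    (hp : 1 < p) (hs : SobolevSubcritical n p) (hpl : 1 + 2 * γ / n ≤ p) {b : ℝ}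
    (hb : b = (p - 1) * (n + 2 * γ) / 4) (hb1 : b < 1) :
    ∃ C : ℝ, 0 < C ∧ ∀ t M : ℝ, 0 ≤ t → 0 ≤ M → ∀ w : ℝ → L2 n, Continuous w →
      (∀ τ ∈ Icc 0 t, ‖weightOp (1 + τ) (w τ)‖ ≤ M * (1 + τ) ^ (-(γ / 2))) →
      ‖weightOp (1 + t) (∫ τ in (0 : ℝ)..t, waveOp (t - τ) (powOp p (w τ)))‖ ≤
        C * M ^ p * (1 + t) ^ (1 - b) * (1 + t) ^ (-(γ / 2)) := by
  obtain ⟨C, hC, h⟩ := duhamel_integrand_le hn hγ hγ' hp hs hpl hb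
  have hb1' : 0 < 1 - b := by linarith
  refine ⟨C * (1 / (1 - b) + 2), by positivity, fun t M ht hM w hw hbd => ?_⟩
  have ht1 : 0 < 1 + t := by linarith
  have hint := intervalIntegrable_volterra (continuous_uncurry_waveOp_powOp hn hp hs)
    (right_mem_Icc.2 ht) hw.continuousOn
  rw [← (weightOp (1 + t)).intervalIntegral_comp_comm hint]
  have hii1 := intervalIntegrable_one_add_rpow (b := b) ht
  have hii2 : IntervalIntegrable (fun τ : ℝ => (1 + (t - τ)) ^ (-(1 / 2 : ℝ))) volume 0 t := by
    apply ContinuousOn.intervalIntegrable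
    rw [uIcc_of_le ht]
    refine ContinuousOn.rpow_const (by fun_prop) fun τ hτ => .inl ?_
    have : 0 ≤ t - τ := sub_nonneg.2 hτ.2
    positivity
  refine (intervalIntegral.norm_integral_le_of_norm_le ht (.of_forall fun τ hτ =>
    h τ t M hτ.1.le hτ.2 hM (w τ) (hbd τ ⟨hτ.1.le, hτ.2⟩))
    ((hii1.add (hii2.const_mul _)).const_mul _)).trans ?_
  rw [intervalIntegral.integral_const_mul, intervalIntegral.integral_add hii1 (hii2.const_mul _),
    intervalIntegral.integral_const_mul, integral_one_add_sub_rpow]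
  have h1 := integral_one_add_rpow_le hb1 t
  have h2 := integral_one_add_rpow_le (b := 1 / 2) (by norm_num) t
  have e1 : (1 + t) ^ (1 / 2 - b) * ((1 + t) ^ (1 - 1 / 2 : ℝ) / (1 - 1 / 2)) =
      2 * (1 + t) ^ (1 - b) := by
    rw [← mul_div_assoc, ← Real.rpow_add ht1]
    norm_num
    rw [show (1 / 2 - b + 1 / 2) = 1 - b by ring]
    ring
  calc _ ≤ C * M ^ p * (1 + t) ^ (-(γ / 2)) * ((1 + t) ^ (1 - b) / (1 - b) +
        (1 + t) ^ (1 / 2 - b) * ((1 + t) ^ (1 - 1 / 2 : ℝ) / (1 - 1 / 2))) := by gcongr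
    _ = _ := by rw [e1]; field_simp

/-! ### Mild solutions as solutions of a Volterra equation -/

/-- The free solution as a curve in `H¹`. -/
def freeSolution {n : ℕ} (ε : ℝ) (w₀ u₁ : L2 n) (t : ℝ) : L2 n :=
  (ε : ℂ) • waveOp0 t w₀ + (ε : ℂ) • waveOp t u₁

theorem continuous_freeSolution {n : ℕ} (ε : ℝ) (w₀ u₁ : L2 n) :
    Continuous (freeSolution ε w₀ u₁) :=
  ((continuous_waveOp0 w₀).fun_const_smul (ε : ℂ)).fun_add
    ((continuous_waveOp u₁).fun_const_smul (ε : ℂ))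

/-- The `L²`-valued Duhamel integral of the definition is the image under `toH1` of an integral
taken in `H¹`. This transfers the equation in both directions. -/
theorem toH1_volterra {n : ℕ} (hn : 1 ≤ n) {p : ℝ} (hp : 1 < p) (hs : SobolevSubcritical n p)
    {ε T t : ℝ} (w₀ u₁ : L2 n) {w g : ℝ → L2 n} (hw : ContinuousOn w (Ico 0 T))
    (hg : ∀ τ ∈ Ico 0 T, g τ = powOp p (w τ)) (ht : t ∈ Ico 0 T) :
    IntervalIntegrable (fun τ => E1 (t - τ) (g τ)) volume 0 t ∧
      toH1 (freeSolution ε w₀ u₁ t + ∫ τ in (0 : ℝ)..t, waveOp (t - τ) (powOp p (w τ))) =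
        (ε : ℂ) • E0 t (toH1 w₀) + (ε : ℂ) • E1 t u₁ + ∫ τ in (0 : ℝ)..t, E1 (t - τ) (g τ) := by
  have hint := intervalIntegrable_volterra (continuous_uncurry_waveOp_powOp hn hp hs)
    (right_mem_Icc.2 ht.1) (hw.mono (Icc_subset_Ico_right ht.2))
  have e : EqOn (fun τ => E1 (t - τ) (g τ)) (fun τ => toH1 (waveOp (t - τ) (powOp p (w τ))))
      (uIcc 0 t) := by
    intro τ hτ
    rw [uIcc_of_le ht.1] at hτ
    change E1 (t - τ) (g τ) = toH1 (waveOp (t - τ) (powOp p (w τ)))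
    rw [hg τ ⟨hτ.1, hτ.2.trans_lt ht.2⟩, toH1_waveOp (sub_nonneg.2 hτ.2)]
  constructor
  · refine IntervalIntegrable.congr (fun τ hτ => (e (uIoc_subset_uIcc hτ)).symm) ?_
    exact ⟨(toH1 : L2 n →L[ℂ] L2 n).integrable_comp hint.1,
      (toH1 : L2 n →L[ℂ] L2 n).integrable_comp hint.2⟩
  · rw [map_add, freeSolution, map_add, map_smul, map_smul, toH1_waveOp0 ht.1, toH1_waveOp ht.1,
      intervalIntegral.integral_congr e, (toH1 : L2 n →L[ℂ] L2 n).intervalIntegral_comp_comm hint]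

theorem isMildSolution_toH1 {n : ℕ} (hn : 1 ≤ n) {p : ℝ} (hp : 1 < p)
    (hs : SobolevSubcritical n p) {ε T : ℝ} {w₀ u₁ : L2 n} {w : ℝ → L2 n}
    (hw : ContinuousOn w (Ico 0 T))
    (he : ∀ t ∈ Ico 0 T, w t = freeSolution ε w₀ u₁ t +
      ∫ τ in (0 : ℝ)..t, waveOp (t - τ) (powOp p (w τ))) :
    IsMildSolution p ε T (toH1 w₀) u₁ fun t => toH1 (w t) := by
  refine ⟨isContinuousInH1_toH1_iff.2 hw, fun τ => powOp p (w τ),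
    fun τ _ => coeFn_powOp hn hp hs (w τ), fun t ht => ?_⟩
  obtain ⟨h1, h2⟩ := toH1_volterra (ε := ε) hn hp hs w₀ u₁ hw (fun _ _ => rfl) ht
  exact ⟨h1, by rw [← h2, ← he t ht]⟩

theorem IsMildSolution.exists_volterra {n : ℕ} (hn : 1 ≤ n) {p : ℝ} (hp : 1 < p)
    (hs : SobolevSubcritical n p) {ε T : ℝ} {w₀ u₁ : L2 n} {v : ℝ → L2 n}
    (h : IsMildSolution p ε T (toH1 w₀) u₁ v) :
    ∃ w : ℝ → L2 n, (∀ t ∈ Ico 0 T, v t = toH1 (w t)) ∧ ContinuousOn w (Ico 0 T) ∧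
      ∀ t ∈ Ico 0 T, w t = freeSolution ε w₀ u₁ t +
        ∫ τ in (0 : ℝ)..t, waveOp (t - τ) (powOp p (w τ)) := by
  obtain ⟨hc, g, hg, heq⟩ := h
  have hex : ∀ t, ∃ w : L2 n, t ∈ Ico 0 T → toH1 w = v t := fun t => by
    by_cases ht : t ∈ Ico 0 T
    · obtain ⟨w, hw⟩ := exists_toH1_eq (hc t ht).1
      exact ⟨w, fun _ => hw⟩
    · exact ⟨0, fun h => absurd h ht⟩
  choose w hw using hex
  have hwc : ContinuousOn w (Ico 0 T) := by
    rw [← isContinuousInH1_toH1_iff]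
    intro t ht
    beta_reduce
    rw [hw t ht]
    refine ⟨(hc t ht).1, (hc t ht).2.congr' ?_⟩
    filter_upwards [self_mem_nhdsWithin] with s hs
    rw [hw s hs]
  have hg' : ∀ τ ∈ Ico 0 T, g τ = powOp p (w τ) := fun τ hτ => by
    apply Lp.ext
    filter_upwards [hg τ hτ, coeFn_powOp hn hp hs (w τ)] with x h1 h2
    rw [h1, h2, hw τ hτ]
  refine ⟨w, fun t ht => (hw t ht).symm, hwc, fun t ht => toH1_injective ?_⟩
  rw [(toH1_volterra (ε := ε) hn hp hs w₀ u₁ hwc hg' ht).2, ← (heq t ht).2, hw t ht]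

/-- Any competing mild solution, of whatever size, lifts to a Volterra solution; on each compact [0,
t] both are bounded and uniqueness applies. -/
theorem existsUniqueMild_of_volterra {n : ℕ} (hn : 1 ≤ n) {p : ℝ} (hp : 1 < p)
    (hs : SobolevSubcritical n p) {ε T : ℝ} {w₀ u₁ : L2 n} {w : ℝ → L2 n}
    (hw : ContinuousOn w (Ico 0 T))
    (he : ∀ t ∈ Ico 0 T, w t = freeSolution ε w₀ u₁ t +
      ∫ τ in (0 : ℝ)..t, waveOp (t - τ) (powOp p (w τ))) :
    ExistsUniqueMild p ε T (toH1 w₀) u₁ := by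
  refine ⟨fun t => toH1 (w t), isMildSolution_toH1 hn hp hs hw he, fun v hv t ht => ?_⟩
  obtain ⟨w', hvw, hw', he'⟩ := hv.exists_volterra hn hp hs
  rw [hvw t ht]
  have hsub : Icc 0 t ⊆ Ico 0 T := Icc_subset_Ico_right ht.2
  congr 1
  exact volterra_unique (continuous_uncurry_waveOp_powOp hn hp hs)
    (waveOp_powOp_lipschitz hn hp hs) (hw'.mono hsub) (hw.mono hsub)
    (fun s hs => he' s (hsub hs)) (fun s hs => he s (hsub hs)) t (right_mem_Icc.2 ht.1)

/-! ### The lifespan -/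

theorem norm_weightOp_freeSolution_le {n : ℕ} (hn : 1 ≤ n) {γ : ℝ} (hγ : 0 ≤ γ) :
    ∃ C : ℝ, 0 < C ∧ ∀ w₀ u₁ : L2 n, MemDataSpace γ (toH1 w₀) u₁ → ∀ ε t : ℝ, 0 ≤ ε → 0 ≤ t →
      ‖weightOp (1 + t) (freeSolution ε w₀ u₁ t)‖ ≤
        ε * (C * dataNorm γ (toH1 w₀) u₁) * (1 + t) ^ (-(γ / 2)) := by
  obtain ⟨C₀, hC₀, h₀⟩ := enorm_weightOp_waveOp0_le hn hγ
  obtain ⟨C₁, hC₁, h₁⟩ := enorm_weightOp_waveOp_le hn hγ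
  refine ⟨C₀ + C₁, by positivity, fun w₀ u₁ ⟨_, hd0, hd1⟩ ε t hε ht => ?_⟩
  have ht1 : 0 < 1 + t := by linarith
  have h0 := h₀ t ht w₀
  have h1 := h₁ t t ht le_rfl u₁
  rw [← ENNReal.ofReal_toReal hd0.ne, ← ofReal_norm, ← ofReal_norm,
    ← ENNReal.ofReal_add ENNReal.toReal_nonneg (norm_nonneg _),
    ← ENNReal.ofReal_mul (by positivity), ENNReal.ofReal_le_ofReal_iff (by positivity)] at h0
  rw [← ENNReal.ofReal_toReal hd1.ne, ← ofReal_norm, ← ofReal_norm,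
    ← ENNReal.ofReal_add ENNReal.toReal_nonneg (norm_nonneg _),
    ← ENNReal.ofReal_mul (by positivity), ENNReal.ofReal_le_ofReal_iff (by positivity),
    div_self ht1.ne', Real.sqrt_one, mul_one] at h1
  have hD : dataNorm γ (toH1 w₀) u₁ = ‖w₀‖ + (negSobolevNorm γ (toH1 w₀)).toReal +
      ‖u₁‖ + (negSobolevNorm γ u₁).toReal := by
    rw [dataNorm, sobolevNorm_toH1, toReal_enorm]
  rw [freeSolution, map_add, map_smul, map_smul]
  refine (norm_add_le _ _).trans ?_
  rw [norm_smul, norm_smul, Complex.norm_real, Real.norm_of_nonneg hε, ← mul_add, mul_assoc]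
  refine mul_le_mul_of_nonneg_left ((add_le_add h0 h1).trans ?_) hε
  have ha := norm_nonneg w₀
  have hb := norm_nonneg u₁
  have hc : 0 ≤ (negSobolevNorm γ (toH1 w₀)).toReal := ENNReal.toReal_nonneg
  have hd : 0 ≤ (negSobolevNorm γ u₁).toReal := ENNReal.toReal_nonneg
  have hx : 0 ≤ (1 + t) ^ (-(γ / 2)) := by positivity
  rw [hD, mul_right_comm C₀, mul_right_comm C₁, ← add_mul]
  refine mul_le_mul_of_nonneg_right ?_ hx
  nlinarith

/-- The two smallness conditions give the free part and the Duhamel part half of the ball M (1 +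
t)^{-γ/2} each, for all t ≤ T. The constants are fixed before the data. -/
theorem existsUniqueMild_of_small {n : ℕ} (hn : 1 ≤ n) {γ p : ℝ} (hγ : 0 < γ) (hγ' : γ < n / 2)
    (hp : 1 < p) (hs : SobolevSubcritical n p) (hpl : 1 + 2 * γ / n ≤ p) {b : ℝ}
    (hb : b = (p - 1) * (n + 2 * γ) / 4) (hb1 : b < 1) :
    ∃ C₁ C₂ : ℝ, 0 < C₁ ∧ 0 < C₂ ∧ ∀ u₀ u₁ : L2 n, MemDataSpace γ u₀ u₁ →
      ∀ ε T M : ℝ, 0 ≤ ε → 0 ≤ T → 0 < M → ε * (C₁ * dataNorm γ u₀ u₁) ≤ M / 2 →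
        C₂ * M ^ (p - 1) * (1 + T) ^ (1 - b) ≤ 1 / 2 → ExistsUniqueMild p ε T u₀ u₁ := by
  obtain ⟨C₁, hC₁, h₁⟩ := norm_weightOp_freeSolution_le hn hγ.le
  obtain ⟨C₂, hC₂, h₂⟩ := norm_weightOp_duhamel_le hn hγ hγ' hp hs hpl hb hb1
  refine ⟨C₁, C₂, hC₁, hC₂, fun u₀ u₁ hu ε T M hε hT hM hdata hsmall => ?_⟩
  obtain ⟨w₀, rfl⟩ := exists_toH1_eq hu.1
  obtain ⟨L, hL, hLip⟩ := waveOp_powOp_lipschitz hn hp hs M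
  have hb1' : 0 < 1 - b := by linarith
  obtain ⟨w, hw, he⟩ := volterra_exists (T := T) (continuous_uncurry_waveOp_powOp hn hp hs) hL hLip
    (continuous_freeSolution ε w₀ u₁)
    -- The guard 0 ≤ t makes 0 a member for every real t, as required; negative times carry no
    -- condition.
    (B := fun t => {w | 0 ≤ t → ‖weightOp (1 + t) w‖ ≤ M * (1 + t) ^ (-(γ / 2))})
    (fun t ht => by rw [map_zero, norm_zero]; positivity)
    (fun t ht w hw => by
      rw [mem_closedBall_zero_iff]
      have ht0 : 0 ≤ t := ht.1
      refine (norm_le_norm_weightOp (by linarith : 1 ≤ 1 + t) w).trans ((hw ht0).trans ?_)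
      exact mul_le_of_le_one_right hM.le
        (Real.rpow_le_one_of_one_le_of_nonpos (by linarith) (by linarith)))
    (fun w hw hwB t ht ht0 => by
      have hT1 := ht.2
      have hx : 0 ≤ (1 + t) ^ (-(γ / 2)) := by positivity
      rw [map_add]
      refine (norm_add_le _ _).trans ((add_le_add (h₁ w₀ u₁ hu ε t hε ht0)
        (h₂ t M ht0 hM.le w hw fun τ hτ => hwB τ ⟨hτ.1, hτ.2.trans ht.2⟩ hτ.1)).trans ?_)
      rw [← add_mul]
      refine mul_le_mul_of_nonneg_right ?_ hx
      have e : M ^ p = M ^ (p - 1) * M := by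
        rw [← Real.rpow_add_one hM.ne']; ring_nf
      have h3 : C₂ * M ^ p * (1 + t) ^ (1 - b) ≤ M / 2 := by
        calc C₂ * M ^ p * (1 + t) ^ (1 - b) ≤ C₂ * M ^ p * (1 + T) ^ (1 - b) := by gcongr
          _ = (C₂ * M ^ (p - 1) * (1 + T) ^ (1 - b)) * M := by rw [e]; ring
          _ ≤ 1 / 2 * M := by gcongr
          _ = M / 2 := by ring
      linarith)
  exact existsUniqueMild_of_volterra hn hp hs (hw.mono Ico_subset_Icc_self)
    (fun t ht => he t (Ico_subset_Icc_self ht))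

theorem sobolevSubcritical_of_le {n : ℕ} {p : ℝ} (hp : 1 < p)
    (h : 2 < n → p ≤ (n : ℝ) / ((n : ℝ) - 2)) : SobolevSubcritical n p := by
  rw [SobolevSubcritical]
  have hp0 : 0 < p := by linarith
  have e : (n : ℝ) * (1 / 2 - 1 / (2 * p)) = n * (p - 1) / (2 * p) := by field_simp
  rw [e, div_le_one (by positivity)]
  rcases le_or_gt n 2 with hn | hn
  · have : (n : ℝ) ≤ 2 := by exact_mod_cast hn
    nlinarith
  · have hn' : (2 : ℝ) < n := by exact_mod_cast hn
    have h1 := h hn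
    rw [le_div_iff₀ (by linarith)] at h1
    linarith

end DampedWave

theorem theorem2p3 (n : ℕ) (hn : 1 ≤ n) (γ p : ℝ)
    (hγ : 0 < γ) (hγ' : γ < min 2 ((n : ℝ) / 2))
    (hp : 1 < p) (hpc : p < DampedWave.pCrit n γ)
    (hp_lower : 1 + 2 * γ / n ≤ p)
    (hp_upper : 2 < n → p ≤ (n : ℝ) / ((n : ℝ) - 2)) :
    ∃ C : ℝ → ℝ, (∀ R, 0 < C R) ∧
      ∀ u₀ u₁ : DampedWave.L2 n, DampedWave.MemDataSpace γ u₀ u₁ →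
        ∃ ε₂ : ℝ, 0 < ε₂ ∧ ∀ ε : ℝ, 0 < ε → ε ≤ ε₂ →
          ENNReal.ofReal (C (DampedWave.dataNorm γ u₀ u₁) *
              ε ^ (-(2 / (2 * p.conjExponent - 2 - (n : ℝ) / 2 - γ))))
            ≤ DampedWave.lifespan p ε u₀ u₁ := by
  have hp1 : 0 < p - 1 := by linarith
  set b : ℝ := (p - 1) * (n + 2 * γ) / 4 with hb
  have hb1 : b < 1 := by
    rw [DampedWave.pCrit] at hpc
    have h1 : p - 1 < 4 / (n + 2 * γ) := by linarith
    rw [lt_div_iff₀ (by positivity)] at h1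
    rw [hb]; linarith
  have hb1' : 0 < 1 - b := by linarith
  -- With 2p' - 2 = 2/(p - 1), the denominator equals 2(1 - b)/(p - 1).
  have hE : 2 / (2 * p.conjExponent - 2 - (n : ℝ) / 2 - γ) = (p - 1) / (1 - b) := by
    have e : 2 * p.conjExponent - 2 - (n : ℝ) / 2 - γ = 2 * ((1 - b) / (p - 1)) := by
      rw [Real.conjExponent, hb]; field_simp; ring
    rw [e, div_mul_eq_div_div, div_self two_ne_zero, one_div_div]
  rw [hE]
  set E : ℝ := (p - 1) / (1 - b) with hEdef
  have hEpos : 0 < E := by positivity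
  obtain ⟨C₁, C₂, hC₁, hC₂, h⟩ := DampedWave.existsUniqueMild_of_small hn hγ
    (hγ'.trans_le (min_le_right _ _)) hp (DampedWave.sobolevSubcritical_of_le hp hp_upper)
    hp_lower hb hb1
  -- With M = 2C₁(|D| + 1)ε, the smallness condition on the Duhamel term reads (1 + T)^{1-b} ≤ c D ·
  -- ε^{-(p-1)}. Using |D| + 1 keeps c positive for every real D and M positive for zero data.
  set c : ℝ → ℝ := fun D => 1 / (2 * C₂ * (2 * C₁ * (|D| + 1)) ^ (p - 1)) with hc
  have hcpos : ∀ D, 0 < c D := fun D => by positivity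
  refine ⟨fun D => 1 / 2 * c D ^ (1 / (1 - b)), fun D => by have := hcpos D; positivity,
    fun u₀ u₁ hu => ?_⟩
  set D := DampedWave.dataNorm γ u₀ u₁ with hD
  have hD0 : 0 ≤ D := by rw [hD, DampedWave.dataNorm]; positivity
  have hcD := hcpos D
  set A : ℝ := 1 / 2 * c D ^ (1 / (1 - b)) with hA
  have hApos : 0 < A := by positivity
  -- This threshold is equivalent to T = A ε^{-E} ≥ 1, which allows 1 + T ≤ 2T; the factor 1/2 in A
  -- compensates for that 2.
  refine ⟨A ^ (1 / E), by positivity, fun ε hε hεle => ?_⟩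
  have hT1 : 1 ≤ A * ε ^ (-E) := by
    have h1 : ε ^ E ≤ A := by
      calc ε ^ E ≤ (A ^ (1 / E)) ^ E := Real.rpow_le_rpow hε.le hεle hEpos.le
        _ = A := by rw [← Real.rpow_mul hApos.le, one_div_mul_cancel hEpos.ne', Real.rpow_one]
    rw [Real.rpow_neg hε.le, ← div_eq_mul_inv, le_div_iff₀ (by positivity), one_mul]
    exact h1
  set T : ℝ := A * ε ^ (-E) with hT
  refine le_sSup ⟨T, ⟨by linarith, ?_⟩, rfl⟩
  refine h u₀ u₁ hu ε T (2 * C₁ * (|D| + 1) * ε) hε.le (by linarith) (by positivity) ?_ ?_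
  · rw [← hD, abs_of_nonneg hD0]
    have : 0 ≤ C₁ * ε := by positivity
    nlinarith
  · have h2 : (1 + T) ^ (1 - b) ≤ c D * ε ^ (-(p - 1)) := by
      calc (1 + T) ^ (1 - b) ≤ (2 * T) ^ (1 - b) := by gcongr; linarith
        _ = (c D ^ (1 / (1 - b)) * ε ^ (-E)) ^ (1 - b) := by rw [hT, hA]; congr 1; ring
        _ = c D * ε ^ (-(p - 1)) := by
          rw [Real.mul_rpow (by positivity) (by positivity), ← Real.rpow_mul hcD.le,
            ← Real.rpow_mul hε.le, one_div_mul_cancel hb1'.ne', Real.rpow_one, hEdef]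
          congr 2
          field_simp
    have hp3 : 0 < (2 * C₁ * (|D| + 1)) ^ (p - 1) := by positivity
    have hp4 : 0 < ε ^ (p - 1) := by positivity
    calc _ ≤ C₂ * (2 * C₁ * (|D| + 1) * ε) ^ (p - 1) * (c D * ε ^ (-(p - 1))) := by gcongr
      _ = 1 / 2 := by
        rw [Real.mul_rpow (by positivity) hε.le, Real.rpow_neg hε.le, hc]
        field_simp
      _ ≤ 1 / 2 := le_rfl

end
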